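/- Let $G=K_6\setminus K_4$ be the graph with vertices $A_0,A_1,B_1,B_2,B_3,B_4$ and the nine edges $A_0A_1$, $A_0B_i$, $A_1B_i$ ($1\le i\le 4$). Let $G'$ be the $4$-uniform hypergraph with vertex set $V(G)\sqcup\{X,Y\}$, where $X,Y$ are two new vertices, and with edge set $\{e\cup\{X,Y\} : e\in E(G)\}$. Let $K_\omega^{(4)}$ be the complete $4$-uniform hypergraph on a countably infinite vertex set. In the strong Ramsey game $\mathcal R(K_\omega^{(4)},G')$ two players, P1 and P2, alternately claim previously unclaimed hyperedges of $K_\omega^{(4)}$, starting with P1; the first player whose claimed hyperedges contain a copy of $G'$ wins, and if neither player achieves this in finite time, the game is declared a draw. **Theorem.** The game $\mathcal R(K_\omega^{(4)},G')$ is a draw, that is, each of the two players has a strategy that guarantees, whatever the opponent does, that the opponent never wins. -/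

import Mathlib

open scoped Hypergraph

/-! ### Boards and targets -/

/-- The complete `r`-uniform hypergraph on the vertex type `α`. -/
def completeUniform (α : Type*) (r : ℕ) : Hypergraph α where
  vertexSet := Set.univ
  edgeSet := {e | e.encard = r}
  subset_vertexSet_of_mem_edgeSet' := fun _ _ => Set.subset_univ _

/-- The complete `4`-uniform hypergraph on countably many vertices. -/
def Komega4 : Hypergraph ℕ := completeUniform ℕ 4

/-- The graph `K₆ ∖ K₄`: the complete graph on the vertices `0, …, 5`, without the edges of the
complete graph on the four vertices `2, 3, 4, 5`. -/
def K6minusK4 : SimpleGraph (Fin 6) :=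
  (⊤ : SimpleGraph (Fin 6)) \ (⊤ : SimpleGraph (Fin 4)).map (Fin.natAdd 2)

/-- The `4`-uniform hypergraph obtained from a graph `G` by adding two new vertices
(`Sum.inr 0` and `Sum.inr 1`) and including both of them in every edge. -/
def addTwoCentres {V : Type*} (G : SimpleGraph V) : Hypergraph (V ⊕ Fin 2) where
  vertexSet := Set.univ
  edgeSet := {e | ∃ s ∈ G.edgeSet, e = Sum.inl '' (s : Set V) ∪ {Sum.inr 0, Sum.inr 1}}
  subset_vertexSet_of_mem_edgeSet' := fun _ _ => Set.subset_univ _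

/-- The set `S` of edges of the board `B` contains (the edges of) an isomorphic copy in `B` of the
hypergraph `H`. -/
def HasCopy {α β : Type*} (B : Hypergraph β) (H : Hypergraph α) (S : Set (Set β)) : Prop :=
  ∃ f : α → β, Set.InjOn f V(H) ∧ Set.MapsTo f V(H) V(B) ∧ ∀ e ∈ E(H), f '' e ∈ S

/-! ### The strong Ramsey game

A history is the list of the edges claimed so far, in chronological order. The first player makes
the moves with index `0, 2, 4, …`, the second player those with index `1, 3, 5, …`. -/

/-- The two players. -/
inductive Player
  | P1
  | P2

/-- The other player. -/
def Player.opponent : Player → Player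
  | .P1 => .P2
  | .P2 => .P1

/-- The player who makes the move with index `k`. -/
def mover (k : ℕ) : Player := if k % 2 = 0 then .P1 else .P2

/-- The set of edges claimed by the player `p` in the history `h`. -/
def claimed {β : Type*} (p : Player) (h : List (Set β)) : Set (Set β) :=
  {e | ∃ k, mover k = p ∧ h[k]? = some e}

/-- The player `p` owns a copy of the target after the history `h`. -/
def Owns {α β : Type*} (B : Hypergraph β) (H : Hypergraph α) (p : Player) (h : List (Set β)) :
    Prop :=
  HasCopy B H (claimed p h)

/-- `h` is a (finite, possibly unfinished) play of the strong Ramsey game on the board `B` with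
target `H`: every move claims an edge of `B` that was not claimed before, and the play stops as soon
as one of the players owns a copy of `H`. -/
def IsPlay {α β : Type*} (B : Hypergraph β) (H : Hypergraph α) (h : List (Set β)) : Prop :=
  h.Nodup ∧ (∀ e ∈ h, e ∈ E(B)) ∧ ∀ k < h.length, ∀ p, ¬ Owns B H p (h.take k)

/-- The play `h` is a win for the player `p`: `p` is the first to own a copy of `H`. -/
def IsWin {α β : Type*} (B : Hypergraph β) (H : Hypergraph α) (p : Player) (h : List (Set β)) :
    Prop :=
  IsPlay B H h ∧ Owns B H p h

/-- In the history `h`, every move of the player `p` was the one prescribed by `σ`. -/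
def Follows {β : Type*} (p : Player) (σ : List (Set β) → Set β) (h : List (Set β)) : Prop :=
  ∀ k e, mover k = p → h[k]? = some e → e = σ (h.take k)

/-- `σ` is a strategy of the player `p`: in every play in which `p` has followed `σ`, in which no
player owns a copy of `H` yet, in which it is the turn of `p` and in which some edge of the board is
unclaimed, `σ` prescribes an unclaimed edge of the board. -/
def IsStrategy {α β : Type*} (B : Hypergraph β) (H : Hypergraph α) (p : Player)
    (σ : List (Set β) → Set β) : Prop :=
  ∀ h, IsPlay B H h → Follows p σ h → mover h.length = p → (∀ q, ¬ Owns B H q h) →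
    (∃ e ∈ E(B), e ∉ h) → σ h ∈ E(B) ∧ σ h ∉ h

/-- `σ` is a drawing strategy of the player `p`: a strategy such that, however the opponent plays,
the opponent does not win (at any finite time). -/
def IsDrawingStrategy {α β : Type*} (B : Hypergraph β) (H : Hypergraph α) (p : Player)
    (σ : List (Set β) → Set β) : Prop :=
  IsStrategy B H p σ ∧ ∀ h, Follows p σ h → ¬ IsWin B H p.opponent h

/-- The strong Ramsey game on the board `B` with target `H` is a draw: each of the two players has a
drawing strategy (so that neither of them has a winning strategy). -/
def RamseyGameIsDraw {α β : Type*} (B : Hypergraph β) (H : Hypergraph α) : Prop :=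
  ∀ p : Player, ∃ σ : List (Set β) → Set β, IsDrawingStrategy B H p σ

/-! ### Books -/

/-! A copy of the target has nine edges: with centres `p`, `q`, spine `s`, `t` and four pages `r`,
these are `{p, q, s, t}` and all `{p, q, s, r}`, `{p, q, t, r}`. All of them contain both centres,
so disjoint edges never belong to the same copy.

An extra edge of the opponent cannot help the hero, so both players may be treated as moving second:
it suffices that the hero, owning nothing, is safe against one edge `e₀` (`isDraw_of_safe`,
`safe_start`). The hero aims at a core (`Core`), a copy lacking one page. From then on he takes `{x,
y, a, z}` with ever new vertices `z`, each time threatening `{x, y, v, z}`. The forced replies never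
add up to a threat, because each has a vertex of its own, and the game goes on forever
(`Core.safe`).

To get a core the hero builds a star of four edges `{k₁, k₂, k₃, b}` away from `e₀`. Only then does
he decide, by a pigeonhole argument, which kernel vertex becomes the spine vertex `a` and which two
become the centres `x`, `y`, so that the edges of the opponent hardly interfere (`safe_of_kernel`).
Reading `{x, y, b, c}` as a graph edge `b c`, he now needs three edges from one leaf to other
leaves. This takes three moves, and every further move he needs is matched by an edge of the
opponent between leaves that is useless together with `e₀`, with `e₁` and with the other such edge
(`Core.safe_of_lost`).

Hence, once the core stands, a threat of the opponent must use eight particular edges, among them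
`e₀`, which is disjoint from the spine edge of the core. The hero blocks it. Afterwards the opponent
can threaten only with the same centres and spine and one new page at a time, which the hero can
always answer (`Perpetual`). At the first pause the core takes over: copies through the replies it
forces have their centres outside `e₀` and contain few edges of the opponent. -/

/-- The copy of the target with centres `p`, `q`, spine `s`, `t` and set of pages `R`. -/
def book (p q s t : ℕ) (R : Finset ℕ) : Finset (Finset ℕ) :=
  insert {p, q, s, t} (R.image (fun r => {p, q, s, r}) ∪ R.image (fun r => {p, q, t, r}))

/-- `K` is the copy of the target with the given (distinct) vertices. -/
structure IsBook (K : Finset (Finset ℕ)) (p q s t : ℕ) (R : Finset ℕ) : Prop where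
  pq : p ≠ q
  ps : p ≠ s
  pt : p ≠ t
  qs : q ≠ s
  qt : q ≠ t
  st : s ≠ t
  pR : p ∉ R
  qR : q ∉ R
  sR : s ∉ R
  tR : t ∉ R
  card : R.card = 4
  eq : K = book p q s t R

/-- `K` is the edge set of a copy of the target. -/
def IsCopy (K : Finset (Finset ℕ)) : Prop := ∃ p q s t R, IsBook K p q s t R

/-- The set `S` of edges contains a copy of the target. -/
def HasBook (S : Finset (Finset ℕ)) : Prop := ∃ K, IsCopy K ∧ K ⊆ S

namespace IsBook

variable {K : Finset (Finset ℕ)} {p q s t : ℕ} {R : Finset ℕ}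

theorem mem_iff (h : IsBook K p q s t R) {e : Finset ℕ} :
    e ∈ K ↔ e = {p, q, s, t} ∨ ∃ r ∈ R, e = {p, q, s, r} ∨ e = {p, q, t, r} := by
  rw [h.eq, book]
  simp only [Finset.mem_insert, Finset.mem_union, Finset.mem_image]
  grind

theorem swapSpine (h : IsBook K p q s t R) : IsBook K p q t s R := by
  refine ⟨h.pq, h.pt, h.ps, h.qt, h.qs, h.st.symm, h.pR, h.qR, h.tR, h.sR, h.card, ?_⟩
  rw [h.eq, book, book, Finset.union_comm]
  congr 1
  grind

theorem swapCentre (h : IsBook K p q s t R) : IsBook K q p s t R := by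
  refine ⟨h.pq.symm, h.qs, h.qt, h.ps, h.pt, h.st, h.qR, h.pR, h.sR, h.tR, h.card, ?_⟩
  rw [h.eq, book, book]
  congr 1
  · grind
  · congr 2 <;> (funext r; grind)

theorem spine_mem (h : IsBook K p q s t R) : {p, q, s, t} ∈ K := h.mem_iff.2 (Or.inl rfl)

theorem left_mem (h : IsBook K p q s t R) {r : ℕ} (hr : r ∈ R) : {p, q, s, r} ∈ K :=
  h.mem_iff.2 (Or.inr ⟨r, hr, Or.inl rfl⟩)

theorem right_mem (h : IsBook K p q s t R) {r : ℕ} (hr : r ∈ R) : {p, q, t, r} ∈ K :=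
  h.mem_iff.2 (Or.inr ⟨r, hr, Or.inr rfl⟩)

theorem p_mem (h : IsBook K p q s t R) {e : Finset ℕ} (he : e ∈ K) : p ∈ e := by
  rcases h.mem_iff.1 he with rfl | ⟨r, -, rfl | rfl⟩ <;> simp

theorem q_mem (h : IsBook K p q s t R) {e : Finset ℕ} (he : e ∈ K) : q ∈ e := by
  rcases h.mem_iff.1 he with rfl | ⟨r, -, rfl | rfl⟩ <;> simp

theorem s_or_t_mem (h : IsBook K p q s t R) {e : Finset ℕ} (he : e ∈ K) : s ∈ e ∨ t ∈ e := by
  rcases h.mem_iff.1 he with rfl | ⟨r, -, rfl | rfl⟩ <;> simp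

theorem card_edge (h : IsBook K p q s t R) {e : Finset ℕ} (he : e ∈ K) : e.card = 4 := by
  rcases h.mem_iff.1 he with rfl | ⟨r, hr, rfl | rfl⟩
  · simp [h.pq, h.ps, h.pt, h.qs, h.qt, h.st]
  · have h1 : p ≠ r := fun e => h.pR (e ▸ hr)
    have h2 : q ≠ r := fun e => h.qR (e ▸ hr)
    have h3 : s ≠ r := fun e => h.sR (e ▸ hr)
    simp [h.pq, h.ps, h.qs, h1, h2, h3]
  · have h1 : p ≠ r := fun e => h.pR (e ▸ hr)
    have h2 : q ≠ r := fun e => h.qR (e ▸ hr)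
    have h3 : t ≠ r := fun e => h.tR (e ▸ hr)
    simp [h.pq, h.pt, h.qt, h1, h2, h3]

end IsBook

theorem injOn_insert_three {p q s : ℕ} {R : Finset ℕ} (hp : p ∉ R) (hq : q ∉ R) (hs : s ∉ R) :
    Set.InjOn (fun r => ({p, q, s, r} : Finset ℕ)) R := by
  intro r hr r' hr' h
  have h1 : r ∈ ({p, q, s, r'} : Finset ℕ) := by
    have : r ∈ ({p, q, s, r} : Finset ℕ) := by simp
    simpa only [h] using this
  simp only [Finset.mem_coe] at hr hr'
  simp only [Finset.mem_insert, Finset.mem_singleton] at h1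
  rcases h1 with rfl | rfl | rfl | h1 <;> simp_all

namespace IsBook

variable {K : Finset (Finset ℕ)} {p q s t : ℕ} {R : Finset ℕ}

theorem card_eq (h : IsBook K p q s t R) : K.card = 9 := by
  have hp := h.pR
  have hq := h.qR
  have hs := h.sR
  have ht := h.tR
  rw [h.eq, book, Finset.card_insert_of_notMem, Finset.card_union_of_disjoint,
    Finset.card_image_of_injOn (injOn_insert_three hp hq hs),
    Finset.card_image_of_injOn (injOn_insert_three hp hq ht), h.card]
  · rw [Finset.disjoint_left]
    intro e he he'
    obtain ⟨r, hr, rfl⟩ := Finset.mem_image.1 he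
    obtain ⟨r', hr', h'⟩ := Finset.mem_image.1 he'
    have h1 : s ∈ ({p, q, t, r'} : Finset ℕ) := by rw [h']; simp
    simp only [Finset.mem_insert, Finset.mem_singleton] at h1
    rcases h1 with h1 | h1 | h1 | h1
    · exact h.ps h1.symm
    · exact h.qs h1.symm
    · exact h.st h1
    · exact hs (h1 ▸ hr')
  · intro he
    rcases Finset.mem_union.1 he with he | he
    · obtain ⟨r, hr, h'⟩ := Finset.mem_image.1 he
      have h1 : t ∈ ({p, q, s, r} : Finset ℕ) := by rw [h']; simp
      simp only [Finset.mem_insert, Finset.mem_singleton] at h1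
      rcases h1 with h1 | h1 | h1 | h1
      · exact h.pt h1.symm
      · exact h.qt h1.symm
      · exact h.st h1.symm
      · exact ht (h1 ▸ hr)
    · obtain ⟨r, hr, h'⟩ := Finset.mem_image.1 he
      have h1 : s ∈ ({p, q, t, r} : Finset ℕ) := by rw [h']; simp
      simp only [Finset.mem_insert, Finset.mem_singleton] at h1
      rcases h1 with h1 | h1 | h1 | h1
      · exact h.ps h1.symm
      · exact h.qs h1.symm
      · exact h.st h1
      · exact hs (h1 ▸ hr)

/-- A vertex that lies in an edge of the copy and is not a centre or a spine vertex is a page. -/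
theorem mem_pages (h : IsBook K p q s t R) {e : Finset ℕ} (he : e ∈ K) {z : ℕ} (hz : z ∈ e)
    (hp : z ≠ p) (hq : z ≠ q) (hs : z ≠ s) (ht : z ≠ t) : z ∈ R := by
  rcases h.mem_iff.1 he with rfl | ⟨r, hr, rfl | rfl⟩ <;>
    simp only [Finset.mem_insert, Finset.mem_singleton] at hz <;> grind

end IsBook

theorem IsCopy.card_eq {K : Finset (Finset ℕ)} (h : IsCopy K) : K.card = 9 := by
  obtain ⟨p, q, s, t, R, h⟩ := h
  exact h.card_eq

theorem IsCopy.card_edge {K : Finset (Finset ℕ)} (h : IsCopy K) {e : Finset ℕ} (he : e ∈ K) :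
    e.card = 4 := by
  obtain ⟨p, q, s, t, R, h⟩ := h
  exact h.card_edge he

/-- Two edges of a copy meet. -/
theorem IsCopy.not_disjoint {K : Finset (Finset ℕ)} (h : IsCopy K) {e e' : Finset ℕ} (he : e ∈ K)
    (he' : e' ∈ K) : ¬ Disjoint e e' := by
  obtain ⟨p, q, s, t, R, h⟩ := h
  exact fun hd => Finset.disjoint_left.1 hd (h.p_mem he) (h.p_mem he')

/-! ### Safe positions

A position with the player `hero` to move is a pair of the set `M` of edges of the hero and the set
`F` of edges of the opponent. -/

/-- In the position `(M, F)` the hero can move so that he owns a copy, or the opponent cannot complete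
a copy at once and every answer leads to a position in `S`. -/
def CanMove (S : Finset (Finset ℕ) → Finset (Finset ℕ) → Prop) (M F : Finset (Finset ℕ)) : Prop :=
  ∃ m : Finset ℕ, m.card = 4 ∧ m ∉ M ∧ m ∉ F ∧ (HasBook (insert m M) ∨
    ∀ e : Finset ℕ, e.card = 4 → e ∉ insert m M →
      ¬ HasBook (insert e F) ∧ S (insert m M) (insert e F))

/-- The hero, who is to move, can go on forever without losing. -/
def Safe (M F : Finset (Finset ℕ)) : Prop :=
  ∃ S : Finset (Finset ℕ) → Finset (Finset ℕ) → Prop, S M F ∧ ∀ M F, S M F → CanMove S M F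

theorem CanMove.mono {S S' : Finset (Finset ℕ) → Finset (Finset ℕ) → Prop}
    (h : ∀ M F, S M F → S' M F) {M F : Finset (Finset ℕ)} (hm : CanMove S M F) :
    CanMove S' M F := by
  obtain ⟨m, h1, h2, h3, h4⟩ := hm
  refine ⟨m, h1, h2, h3, h4.imp id fun h4 e he he' => ?_⟩
  exact ⟨(h4 e he he').1, h _ _ (h4 e he he').2⟩

/-- `Safe` is the union of all families closed under `CanMove`, hence the greatest fixed point of
`CanMove`. -/
theorem Safe.canMove {M F : Finset (Finset ℕ)} (h : Safe M F) : CanMove Safe M F := by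
  obtain ⟨S, h1, h2⟩ := h
  exact (h2 M F h1).mono fun M F h => ⟨S, h, h2⟩

theorem Safe.of_canMove {M F : Finset (Finset ℕ)} (h : CanMove Safe M F) : Safe M F :=
  ⟨fun M F => CanMove Safe M F, h, fun _ _ h => h.mono fun _ _ => Safe.canMove⟩

/-- Coinduction up to `Safe`. -/
theorem Safe.coind (S : Finset (Finset ℕ) → Finset (Finset ℕ) → Prop)
    (h : ∀ M F, S M F → Safe M F ∨ CanMove (fun M F => S M F ∨ Safe M F) M F)
    {M F : Finset (Finset ℕ)} (hS : S M F) : Safe M F := by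
  refine ⟨fun M F => S M F ∨ Safe M F, Or.inl hS, ?_⟩
  rintro M F (h' | h')
  · rcases h M F h' with h' | h'
    · exact h'.canMove.mono fun _ _ => Or.inr
    · exact h'
  · exact h'.canMove.mono fun _ _ => Or.inr

theorem Safe.step {M F : Finset (Finset ℕ)} (m : Finset ℕ) (hm : m.card = 4) (hM : m ∉ M)
    (hF : m ∉ F) (h : ∀ e : Finset ℕ, e.card = 4 → e ∉ insert m M →
      ¬ HasBook (insert e F) ∧ Safe (insert m M) (insert e F)) : Safe M F :=
  .of_canMove ⟨m, hm, hM, hF, Or.inr h⟩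

theorem Safe.win {M F : Finset (Finset ℕ)} (m : Finset ℕ) (hm : m.card = 4) (hM : m ∉ M)
    (hF : m ∉ F) (h : HasBook (insert m M)) : Safe M F :=
  .of_canMove ⟨m, hm, hM, hF, Or.inl h⟩

theorem not_hasBook_of_card {F : Finset (Finset ℕ)} (h : F.card < 9) : ¬ HasBook F := by
  rintro ⟨K, hK, hKF⟩
  have := Finset.card_le_card hKF
  rw [hK.card_eq] at this
  omega

/-- A vertex outside all the edges of `M` and of `F` and outside `A`. -/
theorem exists_fresh (M F : Finset (Finset ℕ)) (A : Finset ℕ) :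
    ∃ z : ℕ, z ∉ A ∧ (∀ e ∈ M, z ∉ e) ∧ ∀ e ∈ F, z ∉ e := by
  obtain ⟨z, hz⟩ := Infinite.exists_notMem_finset (A ∪ M.sup id ∪ F.sup id)
  simp only [Finset.mem_union, Finset.mem_sup, id, not_or, not_exists, not_and] at hz
  exact ⟨z, hz.1.1, hz.1.2, hz.2⟩

/-! ### From safe positions to drawing strategies -/

/-! ### Copies of the target on the board as books. -/

theorem K6minusK4_adj (i j : Fin 6) : K6minusK4.Adj i j ↔ i ≠ j ∧ (i < 2 ∨ j < 2) := by
  simp only [K6minusK4, SimpleGraph.sdiff_adj, SimpleGraph.top_adj]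
  revert i j
  decide

theorem mem_edgeSet_target (e : Set (Fin 6 ⊕ Fin 2)) :
    e ∈ E(addTwoCentres K6minusK4) ↔
      ∃ i j, K6minusK4.Adj i j ∧ e = {.inl i, .inl j, .inr 0, .inr 1} := by
  have key : ∀ i j : Fin 6, (Sum.inl '' ((s(i, j) : Sym2 (Fin 6)) : Set (Fin 6)) ∪
      {Sum.inr 0, Sum.inr 1} : Set (Fin 6 ⊕ Fin 2)) = {.inl i, .inl j, .inr 0, .inr 1} := by
    intro i j
    ext x
    simp only [Set.mem_union, Set.mem_image, SetLike.mem_coe, Sym2.mem_iff, Set.mem_insert_iff,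
      Set.mem_singleton_iff]
    constructor
    · rintro (⟨y, rfl | rfl, rfl⟩ | h)
      · exact Or.inl rfl
      · exact Or.inr (Or.inl rfl)
      · exact Or.inr (Or.inr h)
    · rintro (h | h | h)
      · exact Or.inl ⟨i, Or.inl rfl, h.symm⟩
      · exact Or.inl ⟨j, Or.inr rfl, h.symm⟩
      · exact Or.inr h
  change (∃ s ∈ K6minusK4.edgeSet, e = Sum.inl '' (s : Set (Fin 6)) ∪ {Sum.inr 0, Sum.inr 1}) ↔ _
  constructor
  · rintro ⟨s, hs, rfl⟩
    induction s with
    | _ i j => exact ⟨i, j, hs, key i j⟩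
  · rintro ⟨i, j, hij, rfl⟩
    exact ⟨s(i, j), hij, (key i j).symm⟩

theorem coe_four (a b c d : ℕ) : (({c, d, a, b} : Finset ℕ) : Set ℕ) = {a, b, c, d} := by
  ext x
  simp only [Finset.coe_insert, Finset.coe_singleton, Set.mem_insert_iff, Set.mem_singleton_iff]
  tauto

theorem natAdd_two_ne (i : Fin 4) : (0 : Fin 6) ≠ Fin.natAdd 2 i ∧ (1 : Fin 6) ≠ Fin.natAdd 2 i := by
  revert i
  decide

/-- The vertices `0`, `1` of `K6minusK4` give the spine, the vertices `Fin.natAdd 2 i` the pages,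
and the two added vertices the centres. -/
theorem hasCopy_iff (S : Set (Set ℕ)) :
    HasCopy Komega4 (addTwoCentres K6minusK4) S ↔ ∃ K, IsCopy K ∧ ∀ e ∈ K, (e : Set ℕ) ∈ S := by
  constructor
  · rintro ⟨f, hf, -, hS⟩
    replace hf : Function.Injective f := Set.injOn_univ.1 hf
    have hE : ∀ i j, i ≠ j ∧ (i < 2 ∨ j < 2) →
        ({f (.inl i), f (.inl j), f (.inr 0), f (.inr 1)} : Set ℕ) ∈ S := by
      intro i j hij
      have := hS _ ((mem_edgeSet_target _).2 ⟨i, j, (K6minusK4_adj i j).2 hij, rfl⟩)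
      simpa only [Set.image_insert_eq, Set.image_singleton] using this
    set R : Finset ℕ := (Finset.univ : Finset (Fin 4)).image fun i => f (.inl (Fin.natAdd 2 i))
      with hR
    have hcard : R.card = 4 := by
      rw [hR, Finset.card_image_of_injective]
      · simp
      · intro i j hij
        exact (Fin.natAdd_injective 4 2) (Sum.inl_injective (hf hij))
    have hRm : ∀ x, x ∈ R → ∃ i : Fin 4, x = f (.inl (Fin.natAdd 2 i)) := by
      intro x hx
      obtain ⟨i, -, rfl⟩ := Finset.mem_image.1 hx
      exact ⟨i, rfl⟩
    have hB : IsBook (book (f (.inr 0)) (f (.inr 1)) (f (.inl 0)) (f (.inl 1)) R)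
        (f (.inr 0)) (f (.inr 1)) (f (.inl 0)) (f (.inl 1)) R := by
      refine ⟨?_, ?_, ?_, ?_, ?_, ?_, ?_, ?_, ?_, ?_, hcard, rfl⟩
      any_goals (apply hf.ne; simp)
      all_goals
        intro h
        obtain ⟨i, hi⟩ := hRm _ h
        have h' := hf hi
      · cases h'
      · cases h'
      · exact (natAdd_two_ne i).1 (Sum.inl_injective h')
      · exact (natAdd_two_ne i).2 (Sum.inl_injective h')
    refine ⟨_, ⟨_, _, _, _, _, hB⟩, fun e he => ?_⟩
    rcases hB.mem_iff.1 he with rfl | ⟨r, hr, rfl | rfl⟩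
    · rw [coe_four]
      exact hE 0 1 (by decide)
    · obtain ⟨i, rfl⟩ := hRm r hr
      rw [coe_four]
      exact hE 0 _ ⟨(natAdd_two_ne i).1, Or.inl (by decide)⟩
    · obtain ⟨i, rfl⟩ := hRm r hr
      rw [coe_four]
      exact hE 1 _ ⟨(natAdd_two_ne i).2, Or.inl (by decide)⟩
  · rintro ⟨K, ⟨p, q, s, t, R, hB⟩, hS⟩
    obtain ⟨g, hg⟩ : ∃ g : Fin 4 → ℕ, Function.Injective g ∧ ∀ i, g i ∈ R := by
      let φ := R.equivFinOfCardEq hB.card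
      exact ⟨fun i => φ.symm i, Subtype.val_injective.comp φ.symm.injective,
        fun i => (φ.symm i).2⟩
    obtain ⟨hg, hgR⟩ := hg
    let f : Fin 6 ⊕ Fin 2 → ℕ := Sum.elim (Fin.append ![s, t] g) ![p, q]
    have hgp : ∀ i, g i ≠ p := fun i h => hB.pR (h ▸ hgR i)
    have hgq : ∀ i, g i ≠ q := fun i h => hB.qR (h ▸ hgR i)
    have hgs : ∀ i, g i ≠ s := fun i h => hB.sR (h ▸ hgR i)
    have hgt : ∀ i, g i ≠ t := fun i h => hB.tR (h ▸ hgR i)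
    have f0 : f (.inl 0) = s := rfl
    have f1 : f (.inl 1) = t := rfl
    have f2 : ∀ i : Fin 4, f (.inl (Fin.natAdd 2 i)) = g i := fun i => by
      simp only [f, Sum.elim_inl]
      exact Fin.append_right _ _ _
    have f3 : f (.inr 0) = p := rfl
    have f4 : f (.inr 1) = q := rfl
    have hcase : ∀ i : Fin 6, i = 0 ∨ i = 1 ∨ ∃ j : Fin 4, i = Fin.natAdd 2 j := by decide
    have hcase2 : ∀ i : Fin 2, i = 0 ∨ i = 1 := by decide
    have hst := hB.st
    have hpq := hB.pq
    have hps := hB.ps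
    have hpt := hB.pt
    have hqs := hB.qs
    have hqt := hB.qt
    refine ⟨f, ?_, fun _ _ => Set.mem_univ _, fun e he => ?_⟩
    · refine Function.Injective.injOn ?_
      rintro (i | i) (j | j) hij
      · rcases hcase i with rfl | rfl | ⟨i, rfl⟩ <;> rcases hcase j with rfl | rfl | ⟨j, rfl⟩ <;>
          simp only [f0, f1, f2] at hij <;> grind [Function.Injective]
      · rcases hcase i with rfl | rfl | ⟨i, rfl⟩ <;> rcases hcase2 j with rfl | rfl <;>
          simp only [f0, f1, f2, f3, f4] at hij <;> grind
      · rcases hcase j with rfl | rfl | ⟨j, rfl⟩ <;> rcases hcase2 i with rfl | rfl <;>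
          simp only [f0, f1, f2, f3, f4] at hij <;> grind
      · rcases hcase2 i with rfl | rfl <;> rcases hcase2 j with rfl | rfl <;>
          simp only [f3, f4] at hij <;> grind
    · obtain ⟨i, j, hij, rfl⟩ := (mem_edgeSet_target e).1 he
      rw [K6minusK4_adj] at hij
      have hs : ∀ i : Fin 4, ({s, g i, p, q} : Set ℕ) ∈ S := by
        intro i
        rw [← coe_four]
        exact hS _ (hB.left_mem (hgR i))
      have ht : ∀ i : Fin 4, ({t, g i, p, q} : Set ℕ) ∈ S := by
        intro i
        rw [← coe_four]
        exact hS _ (hB.right_mem (hgR i))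
      have hspine : ({s, t, p, q} : Set ℕ) ∈ S := by
        rw [← coe_four]
        exact hS _ hB.spine_mem
      simp only [Set.image_insert_eq, Set.image_singleton, f3, f4]
      have hlarge : ∀ k : Fin 4, ¬ (Fin.natAdd 2 k : Fin 6) < 2 := by decide
      rcases hcase i with rfl | rfl | ⟨i, rfl⟩ <;> rcases hcase j with rfl | rfl | ⟨j, rfl⟩
      · exact absurd rfl hij.1
      · simpa only [f0, f1] using hspine
      · simpa only [f0, f2] using hs j
      · rw [f0, f1, Set.insert_comm]
        exact hspine
      · exact absurd rfl hij.1
      · simpa only [f1, f2] using ht j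
      · rw [f0, f2, Set.insert_comm]
        exact hs i
      · rw [f1, f2, Set.insert_comm]
        exact ht i
      · rcases hij.2 with h | h
        · exact absurd h (hlarge i)
        · exact absurd h (hlarge j)

theorem mem_Komega4 (e : Set ℕ) : e ∈ E(Komega4) ↔ ∃ m : Finset ℕ, m.card = 4 ∧ (m : Set ℕ) = e := by
  change e.encard = 4 ↔ _
  constructor
  · intro h
    have hfin : e.Finite := Set.finite_of_encard_eq_coe (k := 4) h
    refine ⟨hfin.toFinset, ?_, hfin.coe_toFinset⟩
    have := hfin.encard_eq_coe_toFinset_card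
    rw [h] at this
    exact_mod_cast this.symm
  · rintro ⟨m, hm, rfl⟩
    rw [Set.encard_coe_eq_coe_finsetCard, hm]
    rfl

/-! ### Histories and the positions they lead to. -/

theorem claimed_subset {β : Type*} (p : Player) (h : List (Set β)) {e : Set β}
    (he : e ∈ claimed p h) : e ∈ h := by
  obtain ⟨k, -, hk⟩ := he
  exact List.mem_of_getElem? hk

theorem claimed_finite {β : Type*} (p : Player) (h : List (Set β)) : (claimed p h).Finite :=
  (List.finite_toSet h).subset fun _ he => claimed_subset p h he

theorem mover_eq_or (k : ℕ) (p : Player) : mover k = p ∨ mover k = p.opponent := by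
  cases p <;> unfold mover Player.opponent <;> split_ifs <;> simp

theorem Player.opponent_ne (p : Player) : p.opponent ≠ p := by
  cases p <;> simp [Player.opponent]

theorem mover_succ (k : ℕ) (p : Player) (h : mover k = p) : mover (k + 1) = p.opponent := by
  subst h
  unfold mover Player.opponent
  split_ifs with h1 h2 <;> first | rfl | omega

theorem mem_claimed_append {β : Type*} (p : Player) (h : List (Set β)) (e x : Set β) :
    x ∈ claimed p (h ++ [e]) ↔ x ∈ claimed p h ∨ (mover h.length = p ∧ x = e) := by
  simp only [claimed, Set.mem_ofPred_eq]
  constructor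
  · rintro ⟨k, hk, hx⟩
    rcases lt_trichotomy k h.length with hlt | rfl | hlt
    · rw [List.getElem?_append_left hlt] at hx
      exact Or.inl ⟨k, hk, hx⟩
    · simp only [List.getElem?_concat_length, Option.some.injEq] at hx
      exact Or.inr ⟨hk, hx.symm⟩
    · rw [List.getElem?_eq_none (by simp; omega)] at hx
      cases hx
  · rintro (⟨k, hk, hx⟩ | ⟨hm, rfl⟩)
    · have hlt : k < h.length := (List.getElem?_eq_some_iff.1 hx).1
      exact ⟨k, hk, by rw [List.getElem?_append_left hlt]; exact hx⟩
    · exact ⟨h.length, hm, by simp⟩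

/-- The edges claimed by the player `p` as finite sets. -/
noncomputable def claimedFinset (p : Player) (h : List (Set ℕ)) : Finset (Finset ℕ) :=
  ((claimed_finite p h).preimage (f := fun e : Finset ℕ => (e : Set ℕ))
    Finset.coe_injective.injOn).toFinset

theorem mem_claimedFinset (p : Player) (h : List (Set ℕ)) (m : Finset ℕ) :
    m ∈ claimedFinset p h ↔ (m : Set ℕ) ∈ claimed p h := by
  simp [claimedFinset]

theorem claimedFinset_append_self (p : Player) (h : List (Set ℕ)) (m : Finset ℕ)
    (hp : mover h.length = p) :
    claimedFinset p (h ++ [(m : Set ℕ)]) = insert m (claimedFinset p h) := by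
  ext x
  simp only [mem_claimedFinset, mem_claimed_append, hp, true_and, Finset.mem_insert,
    Finset.coe_inj]
  exact or_comm

theorem claimedFinset_append_of_ne (p : Player) (h : List (Set ℕ)) (e : Set ℕ)
    (hp : mover h.length ≠ p) : claimedFinset p (h ++ [e]) = claimedFinset p h := by
  ext x
  simp [mem_claimedFinset, mem_claimed_append, hp]

theorem hasBook_claimedFinset (p : Player) (h : List (Set ℕ)) :
    HasBook (claimedFinset p h) ↔ Owns Komega4 (addTwoCentres K6minusK4) p h := by
  rw [Owns, hasCopy_iff, HasBook]
  simp only [Finset.subset_iff, mem_claimedFinset]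

theorem HasBook.mono {S S' : Finset (Finset ℕ)} (h : HasBook S) (hS : S ⊆ S') : HasBook S' := by
  obtain ⟨K, hK, hKS⟩ := h
  exact ⟨K, hK, hKS.trans hS⟩

/-- `m` is a move as in `CanMove Safe M F`. -/
def IsSafeMove (M F : Finset (Finset ℕ)) (m : Finset ℕ) : Prop :=
  m.card = 4 ∧ m ∉ M ∧ m ∉ F ∧ (HasBook (insert m M) ∨
    ∀ e : Finset ℕ, e.card = 4 → e ∉ insert m M →
      ¬ HasBook (insert e F) ∧ Safe (insert m M) (insert e F))

open Classical in
/-- The strategy which makes a safe move whenever there is one, where the edges of `P` are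
counted as edges of the opponent. -/
noncomputable def safeStrategy (p : Player) (P : Finset (Finset ℕ)) (h : List (Set ℕ)) : Set ℕ :=
  if hs : ∃ m, IsSafeMove (claimedFinset p h) (P ∪ claimedFinset p.opponent h) m then
    ((hs.choose : Finset ℕ) : Set ℕ)
  else if hu : ∃ e ∈ E(Komega4), e ∉ h then hu.choose else ∅

theorem coe_mem_iff_claimedFinset (p : Player) (h : List (Set ℕ)) (m : Finset ℕ)
    (hm : (m : Set ℕ) ∈ h) : m ∈ claimedFinset p h ∨ m ∈ claimedFinset p.opponent h := by
  obtain ⟨k, hk⟩ := List.mem_iff_getElem?.1 hm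
  rcases mover_eq_or k p with h' | h'
  · exact Or.inl ((mem_claimedFinset _ _ _).2 ⟨k, h', hk⟩)
  · exact Or.inr ((mem_claimedFinset _ _ _).2 ⟨k, h', hk⟩)

theorem isStrategy_safeStrategy (p : Player) (P : Finset (Finset ℕ)) :
    IsStrategy Komega4 (addTwoCentres K6minusK4) p (safeStrategy p P) := by
  intro h _ _ _ _ hu
  unfold safeStrategy
  split_ifs with hs
  · obtain ⟨h1, h2, h3, -⟩ := hs.choose_spec
    refine ⟨(mem_Komega4 _).2 ⟨_, h1, rfl⟩, fun hmem => ?_⟩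
    rcases coe_mem_iff_claimedFinset p h _ hmem with h' | h'
    · exact h2 h'
    · exact h3 (Finset.mem_union_right _ h')
  · exact hu.choose_spec

/-- Induction over the initial segments of the play. Before a move of `p` the position, with `P`
added for the opponent, is safe; after it `p` owns a copy or every reply leads back to a safe
position. -/
theorem isDrawingStrategy_safeStrategy (p : Player) (P : Finset (Finset ℕ))
    (hp : p = .P1 → Safe ∅ P)
    (hp' : p = .P2 → ∀ e : Finset ℕ, e.card = 4 → ¬ HasBook (insert e P) ∧ Safe ∅ (insert e P)) :
    IsDrawingStrategy Komega4 (addTwoCentres K6minusK4) p (safeStrategy p P) := by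
  refine ⟨isStrategy_safeStrategy p P, ?_⟩
  rintro h hσ ⟨⟨hnodup, hboard, hplay⟩, hwin⟩
  have hempty : ∀ p, claimedFinset p [] = ∅ := by
    intro p
    ext x
    simp [mem_claimedFinset, claimed]
  have key : ∀ k ≤ h.length, ¬ Owns Komega4 (addTwoCentres K6minusK4) p.opponent (h.take k) ∧
      (mover k = p → Safe (claimedFinset p (h.take k))
        (P ∪ claimedFinset p.opponent (h.take k))) ∧
      (mover k = p.opponent → Owns Komega4 (addTwoCentres K6minusK4) p (h.take k) ∨
        ∀ e : Finset ℕ, e.card = 4 → e ∉ claimedFinset p (h.take k) →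
        ¬ HasBook (insert e (P ∪ claimedFinset p.opponent (h.take k))) ∧
        Safe (claimedFinset p (h.take k))
          (insert e (P ∪ claimedFinset p.opponent (h.take k)))) := by
    intro k
    induction k with
    | zero =>
      intro _
      simp only [List.take_zero, hempty, Finset.union_empty]
      refine ⟨?_, fun h0 => hp h0.symm, fun h0 => Or.inr fun e he _ => hp' ?_ e he⟩
      · rw [← hasBook_claimedFinset, hempty]
        exact not_hasBook_of_card (by simp)
      · cases p
        · simp [mover, Player.opponent] at h0
        · rfl
    | succ k ih =>
      intro hk
      obtain ⟨ih1, ih2, ih3⟩ := ih (by omega)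
      have hklt : k < h.length := hk
      have htake : h.take (k + 1) = h.take k ++ [h[k]] := List.take_succ_eq_append_getElem hklt
      have hlen : (h.take k).length = k := by simp; omega
      obtain ⟨m, hm4, hm⟩ := (mem_Komega4 _).1 (hboard _ (List.getElem_mem hklt))
      rw [htake, ← hm]
      rcases mover_eq_or k p with hmov | hmov
      · have hne : mover (h.take k).length ≠ p.opponent := by
          rw [hlen, hmov]
          exact p.opponent_ne.symm
        rw [claimedFinset_append_self _ _ _ (by rw [hlen, hmov]),
          claimedFinset_append_of_ne _ _ _ hne]
        refine ⟨?_, ?_, fun _ => ?_⟩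
        · rw [← hasBook_claimedFinset, claimedFinset_append_of_ne _ _ _ hne,
            hasBook_claimedFinset]
          exact ih1
        · intro h'
          rw [mover_succ k p hmov] at h'
          exact absurd h' p.opponent_ne
        · have hs : ∃ m, IsSafeMove (claimedFinset p (h.take k))
              (P ∪ claimedFinset p.opponent (h.take k)) m := (ih2 hmov).canMove
          have hmσ := hσ k h[k] hmov (List.getElem?_eq_getElem hklt)
          rw [safeStrategy, dif_pos hs, ← hm, Finset.coe_inj] at hmσ
          obtain ⟨-, -, -, h4⟩ := hs.choose_spec
          rw [← hmσ] at h4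
          rw [← hasBook_claimedFinset, claimedFinset_append_self _ _ _ (by rw [hlen, hmov])]
          exact h4
      · have hne : mover (h.take k).length ≠ p := by
          rw [hlen, hmov]
          exact p.opponent_ne
        have hlen' : mover (h.take k).length = p.opponent := by rw [hlen, hmov]
        have hmem : m ∉ claimedFinset p (h.take k) := by
          intro hmem
          rw [mem_claimedFinset, hm] at hmem
          have h1 := claimed_subset _ _ hmem
          have h2 : (h.take k ++ [h[k]]).Nodup := htake ▸ hnodup.sublist (List.take_sublist _ _)
          rw [List.nodup_append] at h2
          exact h2.2.2 _ h1 _ (by simp) rfl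
        rw [claimedFinset_append_self p.opponent _ _ hlen',
          claimedFinset_append_of_ne p _ _ hne]
        rcases ih3 hmov with h' | h'
        -- A play ends as soon as a copy is owned, so there would be no further move.
        · exact absurd h' (hplay k hklt p)
        · obtain ⟨h1, h2⟩ := h' m hm4 hmem
          rw [Finset.union_insert]
          refine ⟨?_, fun _ => h2, fun h'' => ?_⟩
          · rw [← hasBook_claimedFinset, claimedFinset_append_self _ _ _ hlen']
            exact fun h3 => h1 (h3.mono (Finset.insert_subset_insert _
              Finset.subset_union_right))
          · have h3 := mover_succ k _ hmov
            rw [h3] at h''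
            cases p <;> simp [Player.opponent] at h''
  have := (key h.length le_rfl).1
  rw [List.take_length] at this
  exact this hwin

/-- The first player pretends that the opponent already owns `{0, 1, 2, 3}`. The opponent may really
claim this edge later, which is covered because `CanMove` admits replies that lie in `F`. -/
theorem isDraw_of_safe (h : ∀ e : Finset ℕ, e.card = 4 → Safe ∅ {e}) :
    RamseyGameIsDraw Komega4 (addTwoCentres K6minusK4) := by
  rintro (_ | _)
  · refine ⟨safeStrategy .P1 {{0, 1, 2, 3}}, isDrawingStrategy_safeStrategy _ _ ?_ (by simp)⟩
    exact fun _ => h _ (by decide)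
  · refine ⟨safeStrategy .P2 ∅, isDrawingStrategy_safeStrategy _ _ (by simp) ?_⟩
    exact fun _ e he => ⟨not_hasBook_of_card (by simp), h e he⟩

/-! ### Perpetual threats -/

theorem card_four {a b c d : ℕ} (hab : a ≠ b) (hac : a ≠ c) (had : a ≠ d) (hbc : b ≠ c)
    (hbd : b ≠ d) (hcd : c ≠ d) : ({a, b, c, d} : Finset ℕ).card = 4 := by
  simp [hab, hac, had, hbc, hbd, hcd]

theorem ne_of_card_four {a b c d : ℕ} (h : ({a, b, c, d} : Finset ℕ).card = 4) :
    a ≠ b ∧ a ≠ c ∧ a ≠ d ∧ b ≠ c ∧ b ≠ d ∧ c ≠ d := by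
  have h3 : ∀ u v w : ℕ, ({u, v, w} : Finset ℕ).card ≤ 3 := fun u v w => Finset.card_le_three
  refine ⟨?_, ?_, ?_, ?_, ?_, ?_⟩ <;> rintro rfl
  · have := h3 a c d; simp_all
  · have := h3 b a d; rw [show ({a, b, a, d} : Finset ℕ) = {b, a, d} by grind] at h; omega
  · have := h3 b c a; rw [show ({a, b, c, a} : Finset ℕ) = {b, c, a} by grind] at h; omega
  · have := h3 a b d; rw [show ({a, b, b, d} : Finset ℕ) = {a, b, d} by grind] at h; omega
  · have := h3 a b c; rw [show ({a, b, c, b} : Finset ℕ) = {a, b, c} by grind] at h; omega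
  · have := h3 a b c; rw [show ({a, b, c, c} : Finset ℕ) = {a, b, c} by grind] at h; omega

theorem eq_four {e : Finset ℕ} (he : e.card = 4) {a b c d : ℕ} (ha : a ∈ e) (hb : b ∈ e)
    (hc : c ∈ e) (hd : d ∈ e) (hab : a ≠ b) (hac : a ≠ c) (had : a ≠ d) (hbc : b ≠ c)
    (hbd : b ≠ d) (hcd : c ≠ d) : e = {a, b, c, d} := by
  symm
  refine Finset.eq_of_subset_of_card_le ?_ (by rw [he, card_four hab hac had hbc hbd hcd])
  intro x hx
  simp only [Finset.mem_insert, Finset.mem_singleton] at hx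
  rcases hx with rfl | rfl | rfl | rfl <;> assumption

/-- The hero owns all edges of a copy with centres `x`, `y` and spine `a`, `v`, except for one page;
the other pages are the elements of `Q`. -/
structure Core (M : Finset (Finset ℕ)) (x y a v : ℕ) (Q : Finset ℕ) : Prop where
  xy : x ≠ y
  xa : x ≠ a
  xv : x ≠ v
  ya : y ≠ a
  yv : y ≠ v
  av : a ≠ v
  xQ : x ∉ Q
  yQ : y ∉ Q
  aQ : a ∉ Q
  vQ : v ∉ Q
  card : Q.card = 3
  spine : {x, y, a, v} ∈ M
  left : ∀ r ∈ Q, {x, y, a, r} ∈ M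
  right : ∀ r ∈ Q, {x, y, v, r} ∈ M

namespace Core

variable {M M' : Finset (Finset ℕ)} {x y a v : ℕ} {Q : Finset ℕ}

theorem mono (h : Core M x y a v Q) (hM : M ⊆ M') : Core M' x y a v Q :=
  { h with
    spine := hM h.spine
    left := fun r hr => hM (h.left r hr)
    right := fun r hr => hM (h.right r hr) }

theorem swap (h : Core M x y a v Q) : Core M x y v a Q where
  xy := h.xy
  xa := h.xv
  xv := h.xa
  ya := h.yv
  yv := h.ya
  av := h.av.symm
  xQ := h.xQ
  yQ := h.yQ
  aQ := h.vQ
  vQ := h.aQ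
  card := h.card
  spine := by
    rw [show ({x, y, v, a} : Finset ℕ) = {x, y, a, v} by grind]
    exact h.spine
  left := h.right
  right := h.left

theorem hasBook (h : Core M x y a v Q) {z : ℕ} (hx : z ≠ x) (hy : z ≠ y) (ha : z ≠ a) (hv : z ≠ v)
    (hQ : z ∉ Q) (hz : {x, y, a, z} ∈ M) : HasBook (insert {x, y, v, z} M) := by
  have hB : IsBook (book x y a v (insert z Q)) x y a v (insert z Q) := by
    refine ⟨h.xy, h.xa, h.xv, h.ya, h.yv, h.av, ?_, ?_, ?_, ?_, ?_, rfl⟩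
    · simp [hx.symm, h.xQ]
    · simp [hy.symm, h.yQ]
    · simp [ha.symm, h.aQ]
    · simp [hv.symm, h.vQ]
    · rw [Finset.card_insert_of_notMem hQ, h.card]
  refine ⟨_, ⟨_, _, _, _, _, hB⟩, fun e he => ?_⟩
  rcases hB.mem_iff.1 he with rfl | ⟨r, hr, hr'⟩
  · exact Finset.mem_insert_of_mem h.spine
  · rcases Finset.mem_insert.1 hr with rfl | hr <;> rcases hr' with rfl | rfl
    · exact Finset.mem_insert_of_mem hz
    · exact Finset.mem_insert_self _ _
    · exact Finset.mem_insert_of_mem (h.left r hr)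
    · exact Finset.mem_insert_of_mem (h.right r hr)

end Core

namespace IsBook

variable {K : Finset (Finset ℕ)} {p q s t : ℕ} {R : Finset ℕ}

/-- This separates spine vertices from pages, which lie in only two edges. -/
theorem four_le_card_spine (h : IsBook K p q s t R) : 4 ≤ (K.filter (s ∈ ·)).card := by
  rw [← h.card, ← Finset.card_image_of_injOn (injOn_insert_three h.pR h.qR h.sR)]
  refine Finset.card_le_card fun e he => ?_
  obtain ⟨r, hr, rfl⟩ := Finset.mem_image.1 he
  exact Finset.mem_filter.2 ⟨h.left_mem hr, by simp⟩

theorem four_le_card_centre (h : IsBook K p q s t R) : 4 ≤ (K.filter (p ∈ ·)).card := by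
  rw [Finset.filter_true_of_mem fun e he => h.p_mem he, h.card_eq]
  omega

/-- The vertices that lie in few edges are the pages. -/
theorem mem_pages_of_card (h : IsBook K p q s t R) {e : Finset ℕ} (he : e ∈ K) {z : ℕ}
    (hz : z ∈ e) (hcard : (K.filter (z ∈ ·)).card < 4) : z ∈ R := by
  refine h.mem_pages he hz ?_ ?_ ?_ ?_ <;> rintro rfl
  · exact absurd h.four_le_card_centre (by omega)
  · exact absurd h.swapCentre.four_le_card_centre (by omega)
  · exact absurd h.four_le_card_spine (by omega)
  · exact absurd h.swapSpine.four_le_card_spine (by omega)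

end IsBook

/-- If the opponent threatens nothing, and could not threaten anything with an edge `{x, y, v, z}`
with a new vertex `z`, then the owner of a core draws by threats at new pages. -/
theorem Core.safe {M F : Finset (Finset ℕ)} {x y a v : ℕ} {Q : Finset ℕ} (hc : Core M x y a v Q)
    (hd : Disjoint F M) (h1 : ∀ K, IsCopy K → Disjoint K M → 2 ≤ (K \ F).card)
    (h2 : ∀ K z, IsCopy K → Disjoint K M → (∀ e ∈ F, z ∉ e) → {x, y, v, z} ∈ K →
      {x, y, a, z} ∉ K → 3 ≤ (K \ F).card) : Safe M F := by
  -- `Z` collects the new pages played so far: the hero has `{x, y, a, z}`, and the opponent was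
  -- forced to take `{x, y, v, z}`.
  refine Safe.coind (fun M' F' => M ⊆ M' ∧ Disjoint F' M' ∧ ∃ Z : Finset ℕ,
    F' = F ∪ Z.image (fun z => {x, y, v, z}) ∧ ∀ z ∈ Z, z ≠ x ∧ z ≠ y ∧ z ≠ v ∧
      {x, y, a, z} ∈ M' ∧ ∀ e ∈ F, z ∉ e) ?_ ⟨subset_rfl, hd, ∅, by simp, by simp⟩
  rintro M' F' ⟨hM, hd', Z, rfl, hZ⟩
  set F' := F ∪ Z.image (fun z => {x, y, v, z}) with hF'
  have hlone : ∀ z ∈ Z, ∀ e ∈ F', z ∈ e → e = {x, y, v, z} := by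
    intro z hz e he hze
    rcases Finset.mem_union.1 he with he | he
    · exact absurd hze ((hZ z hz).2.2.2.2 e he)
    · obtain ⟨z', hz', rfl⟩ := Finset.mem_image.1 he
      obtain ⟨hx, hy, hv, -⟩ := hZ z hz
      simp only [Finset.mem_insert, Finset.mem_singleton, hx, hy, hv, false_or] at hze
      rw [hze]
  have hno : ∀ K, IsCopy K → Disjoint K M' → 2 ≤ (K \ F').card := by
    intro K hK hKM
    have hKM0 : Disjoint K M := hKM.mono_right hM
    by_contra! hlt
    -- Apart from `{x, y, v, z}`, only missing edges of `K` can pass through `z`, and at most one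
    -- edge is missing. So `z` lies in at most two edges of `K`.
    have hpage : ∀ p q s t R, IsBook K p q s t R → ∀ z ∈ Z, {x, y, v, z} ∈ K → z ∈ R := by
      intro p q s t R hB z hz hzK
      refine hB.mem_pages_of_card hzK (by simp) ?_
      have hsub : K.filter (z ∈ ·) ⊆ insert {x, y, v, z} (K \ F') := by
        intro e he
        rw [Finset.mem_filter] at he
        rw [Finset.mem_insert, Finset.mem_sdiff]
        by_cases heF : e ∈ F'
        · exact Or.inl (hlone z hz e heF he.2)
        · exact Or.inr ⟨he.1, heF⟩
      have := (Finset.card_le_card hsub).trans (Finset.card_insert_le _ _)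
      omega
    by_cases hex : ∃ z ∈ Z, {x, y, v, z} ∈ K
    · obtain ⟨z, hz, hzK⟩ := hex
      obtain ⟨p, q, s, t, R, hB⟩ := hK
      -- Each new page lacks an edge of its own, while at most one edge is missing; so `K` uses only
      -- one new page.
      have hother : ∀ z' ∈ Z, {x, y, v, z'} ∈ K → z' = z := by
        intro z' hz' hz'K
        by_contra hne
        have hzR := hpage _ _ _ _ _ hB z hz hzK
        have hz'R := hpage _ _ _ _ _ hB z' hz' hz'K
        have hmiss : ∀ w ∈ Z, w ∈ R → ∃ e ∈ K \ F', e = {p, q, s, w} ∨ e = {p, q, t, w} := by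
          intro w hw hwR
          by_contra! hcon
          have ha : {p, q, s, w} ∈ F' := by
            by_contra h'
            exact (hcon _ (Finset.mem_sdiff.2 ⟨hB.left_mem hwR, h'⟩)).1 rfl
          have hb : {p, q, t, w} ∈ F' := by
            by_contra h'
            exact (hcon _ (Finset.mem_sdiff.2 ⟨hB.right_mem hwR, h'⟩)).2 rfl
          have := (hlone w hw _ ha (by simp)).trans (hlone w hw _ hb (by simp)).symm
          have hs : s ∈ ({p, q, t, w} : Finset ℕ) := by rw [← this]; simp
          have hps := hB.ps
          have hqs := hB.qs
          have hst := hB.st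
          have hsR := hB.sR
          grind
        obtain ⟨e, he, hez⟩ := hmiss z hz hzR
        obtain ⟨e', he', hez'⟩ := hmiss z' hz' hz'R
        have hee : e = e' := Finset.card_le_one.1 (by omega) e he e' he'
        have hz'e : z' ∈ e := by
          rw [hee]
          rcases hez' with rfl | rfl <;> simp
        have hpR := hB.pR
        have hqR := hB.qR
        have hsR := hB.sR
        have htR := hB.tR
        rcases hez with rfl | rfl <;> simp only [Finset.mem_insert, Finset.mem_singleton] at hz'e <;>
          grind
      have hsub : K \ F ⊆ insert {x, y, v, z} (K \ F') := by
        intro e he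
        rw [Finset.mem_sdiff] at he
        rw [Finset.mem_insert, Finset.mem_sdiff]
        by_cases heF : e ∈ F'
        · rcases Finset.mem_union.1 heF with h' | h'
          · exact absurd h' he.2
          · obtain ⟨z', hz', rfl⟩ := Finset.mem_image.1 h'
            rw [hother z' hz' he.1]
            exact Or.inl rfl
        · exact Or.inr ⟨he.1, heF⟩
      -- The hero owns `{x, y, a, z}`, so `h2` applies: three edges are missing from `F`, and the
      -- single new edge supplies only one of them.
      have h3 := h2 K z ⟨p, q, s, t, R, hB⟩ hKM0 (hZ z hz).2.2.2.2 hzK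
        (fun h' => Finset.disjoint_left.1 hKM h' (hZ z hz).2.2.2.1)
      have := (Finset.card_le_card hsub).trans (Finset.card_insert_le _ _)
      omega
    · push Not at hex
      have hsub : K \ F ⊆ K \ F' := by
        intro e he
        rw [Finset.mem_sdiff] at he ⊢
        refine ⟨he.1, fun heF => ?_⟩
        rcases Finset.mem_union.1 heF with h' | h'
        · exact he.2 h'
        · obtain ⟨z', hz', rfl⟩ := Finset.mem_image.1 h'
          exact hex z' hz' he.1
      have := Finset.card_le_card hsub
      have := h1 K hK hKM0
      omega
  right
  obtain ⟨z, hzA, hzM, hzF⟩ := exists_fresh M' F' (insert x (insert y (insert a (insert v Q))))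
  simp only [Finset.mem_insert, not_or] at hzA
  obtain ⟨hzx, hzy, hza, hzv, hzQ⟩ := hzA
  refine ⟨{x, y, a, z}, card_four hc.xy hc.xa (Ne.symm hzx) hc.ya (Ne.symm hzy) (Ne.symm hza),
    fun h => hzM _ h (by simp), fun h => hzF _ h (by simp), Or.inr fun e he heM => ⟨?_, ?_⟩⟩
  · rintro ⟨K, hK, hKF⟩
    have hKM : Disjoint K M' := by
      rw [Finset.disjoint_left]
      intro g hg hgM
      rcases Finset.mem_insert.1 (hKF hg) with rfl | hgF
      · exact heM (Finset.mem_insert_of_mem hgM)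
      · exact Finset.disjoint_left.1 hd' hgF hgM
    have hsub : K \ F' ⊆ {e} := by
      intro g hg
      rw [Finset.mem_sdiff] at hg
      rcases Finset.mem_insert.1 (hKF hg.1) with rfl | hgF
      · simp
      · exact absurd hgF hg.2
    have := Finset.card_le_card hsub
    have := hno K hK hKM
    simp only [Finset.card_singleton] at *
    omega
  · have hnew : ({x, y, v, z} : Finset ℕ) ≠ {x, y, a, z} := by
      intro h
      have : v ∈ ({x, y, a, z} : Finset ℕ) := by rw [← h]; simp
      have := hc.xv
      have := hc.yv
      have := hc.av
      grind
    by_cases hev : e = {x, y, v, z}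
    · subst hev
      left
      refine ⟨hM.trans (Finset.subset_insert _ _), ?_, insert z Z, ?_, ?_⟩
      · rw [Finset.disjoint_insert_right, Finset.disjoint_insert_left]
        refine ⟨?_, fun h => heM (Finset.mem_insert_of_mem h), hd'⟩
        intro h
        rcases Finset.mem_insert.1 h with h | h
        · exact hnew h.symm
        · exact hzF _ h (by simp)
      · rw [Finset.image_insert, Finset.union_insert]
      · intro w hw
        rcases Finset.mem_insert.1 hw with rfl | hw
        · exact ⟨hzx, hzy, hzv, Finset.mem_insert_self _ _,
            fun e he => hzF e (Finset.mem_union_left _ he)⟩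
        · obtain ⟨h1, h2, h3, h4, h5⟩ := hZ w hw
          exact ⟨h1, h2, h3, Finset.mem_insert_of_mem h4, h5⟩
    -- The opponent ignored the threat, and the page `z` completes a copy.
    · right
      refine Safe.win {x, y, v, z} (card_four hc.xy hc.xv (Ne.symm hzx) hc.yv (Ne.symm hzy) (Ne.symm hzv)) ?_ ?_
        ((hc.mono (hM.trans (Finset.subset_insert _ _))).hasBook hzx hzy hza hzv hzQ
          (Finset.mem_insert_self _ _))
      · intro h
        rcases Finset.mem_insert.1 h with h | h
        · exact hnew h
        · exact hzM _ h (by simp)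
      · intro h
        rcases Finset.mem_insert.1 h with h | h
        · exact hev h.symm
        · exact hzF _ h (by simp)

/-- A copy which the opponent nearly owns and which contains an edge with a new vertex. -/
theorem IsCopy.exists_pages_of_fresh {K F : Finset (Finset ℕ)} (hK : IsCopy K) {x y v z : ℕ}
    (hz : ∀ e ∈ F, z ∉ e) (hzK : {x, y, v, z} ∈ K) (hcard : (K \ F).card < 3) :
    ∃ p q s t R, IsBook K p q s t R ∧ z ∈ R ∧ ({p, q, s} : Finset ℕ) = {x, y, v} ∧
      ∀ e ∈ K, z ∉ e → e ∈ F := by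
  obtain ⟨p, q, s, t, R, hB⟩ := hK
  have hsub : K.filter (z ∈ ·) ⊆ K \ F := by
    intro e he
    rw [Finset.mem_filter] at he
    exact Finset.mem_sdiff.2 ⟨he.1, fun h => hz e h he.2⟩
  have hzR : z ∈ R := by
    refine hB.mem_pages_of_card hzK (by simp) ?_
    have := Finset.card_le_card hsub
    omega
  have hne := ne_of_card_four (hB.card_edge hzK)
  have hpR := hB.pR
  have hqR := hB.qR
  have hsR := hB.sR
  have htR := hB.tR
  have hps := hB.ps
  have hqs := hB.qs
  have hst := hB.st
  -- Both edges at the page `z` are missing already, and a third missing edge would contradict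
  -- `hcard`.
  have hF : ∀ e ∈ K, z ∉ e → e ∈ F := by
    intro e he hze
    by_contra heF
    have h3 : ({e, {p, q, s, z}, {p, q, t, z}} : Finset (Finset ℕ)) ⊆ K \ F := by
      intro g hg
      simp only [Finset.mem_insert, Finset.mem_singleton] at hg
      rcases hg with rfl | rfl | rfl
      · exact Finset.mem_sdiff.2 ⟨he, heF⟩
      · exact hsub (Finset.mem_filter.2 ⟨hB.left_mem hzR, by simp⟩)
      · exact hsub (Finset.mem_filter.2 ⟨hB.right_mem hzR, by simp⟩)
    have h4 := Finset.card_le_card h3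
    rw [Finset.card_eq_three.2 ⟨e, {p, q, s, z}, {p, q, t, z}, ?_, ?_, ?_, rfl⟩] at h4
    · omega
    · rintro rfl
      simp at hze
    · rintro rfl
      simp at hze
    · intro h
      have : s ∈ ({p, q, t, z} : Finset ℕ) := by rw [← h]; simp
      grind
  have herase : ∀ u v w : ℕ, u ≠ z → v ≠ z → w ≠ z →
      ({u, v, w, z} : Finset ℕ).erase z = {u, v, w} := by grind
  obtain ⟨-, -, h1, -, h2, h3⟩ := hne
  have hzp : p ≠ z := fun h => hpR (h ▸ hzR)
  have hzq : q ≠ z := fun h => hqR (h ▸ hzR)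
  have hzs : s ≠ z := fun h => hsR (h ▸ hzR)
  have hzt : t ≠ z := fun h => htR (h ▸ hzR)
  rcases hB.mem_iff.1 hzK with h | ⟨r, hr, h⟩
  · have : z ∈ ({p, q, s, t} : Finset ℕ) := by rw [← h]; simp
    grind
  · obtain rfl : z = r := by
      have : z ∈ ({p, q, s, r} : Finset ℕ) ∨ z ∈ ({p, q, t, r} : Finset ℕ) := by
        rcases h with h | h
        · left; rw [← h]; simp
        · right; rw [← h]; simp
      grind
    -- The spine vertex in the edge `{x, y, v, z}` is the one to be called `s`.
    rcases h with h | h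
    · refine ⟨p, q, s, t, R, hB, hzR, ?_, hF⟩
      rw [← herase p q s hzp hzq hzs, ← h, herase x y v h1 h2 h3]
    · refine ⟨p, q, t, s, R, hB.swapSpine, hzR, ?_, hF⟩
      rw [← herase p q t hzp hzq hzt, ← h, herase x y v h1 h2 h3]

/-- The owner of a core draws if the opponent threatens nothing and has at most ten edges, one of them
far from the core. -/
theorem Core.safe_of_card {M F : Finset (Finset ℕ)} {x y a v : ℕ} {Q : Finset ℕ}
    (hc : Core M x y a v Q) (hd : Disjoint F M) (hF : F.card ≤ 10) {e₀ : Finset ℕ} (he₀ : e₀ ∈ F)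
    (hdisj : Disjoint e₀ {x, y, a, v}) (h1 : ∀ K, IsCopy K → Disjoint K M → 2 ≤ (K \ F).card) :
    Safe M F := by
  by_contra hns
  -- The spine vertices `a` and `v` may be exchanged. If both choices fail, there are two nearly
  -- finished copies: `K` with a new page at `v` and `K'` with a new page at `a`.
  have h2 : ¬ ∀ K z, IsCopy K → Disjoint K M → (∀ e ∈ F, z ∉ e) → {x, y, v, z} ∈ K →
      {x, y, a, z} ∉ K → 3 ≤ (K \ F).card := fun h => hns (hc.safe hd h1 h)
  have h2' : ¬ ∀ K z, IsCopy K → Disjoint K M → (∀ e ∈ F, z ∉ e) → {x, y, a, z} ∈ K →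
      {x, y, v, z} ∉ K → 3 ≤ (K \ F).card := fun h => hns (hc.swap.safe hd h1 h)
  push Not at h2 h2'
  obtain ⟨K, z, hK, hKM, hz, hzK, -, hcard⟩ := h2
  obtain ⟨K', z', hK', hKM', hz', hzK', -, hcard'⟩ := h2'
  obtain ⟨p, q, s, t, R, hB, hzR, hpqs, hKF⟩ := hK.exists_pages_of_fresh hz hzK hcard
  obtain ⟨p', q', s', t', R', hB', hzR', hpqs', hKF'⟩ :=
    hK'.exists_pages_of_fresh hz' hzK' hcard'
  have hxe : x ∉ e₀ := fun h => Finset.disjoint_left.1 hdisj h (by simp)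
  have hye : y ∉ e₀ := fun h => Finset.disjoint_left.1 hdisj h (by simp)
  have hae : a ∉ e₀ := fun h => Finset.disjoint_left.1 hdisj h (by simp)
  have hve : v ∉ e₀ := fun h => Finset.disjoint_left.1 hdisj h (by simp)
  have hp : p ∈ ({x, y, v} : Finset ℕ) := by rw [← hpqs]; simp
  have hp' : p' ∈ ({x, y, a} : Finset ℕ) := by rw [← hpqs']; simp
  -- the edges of the opponent in the first copy
  have hT : 7 ≤ (K.filter (z ∉ ·)).card := by
    have h3 : (K.filter (z ∈ ·)).card ≤ (K \ F).card := by
      refine Finset.card_le_card fun e he => ?_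
      rw [Finset.mem_filter] at he
      exact Finset.mem_sdiff.2 ⟨he.1, fun h => hz e h he.2⟩
    have h4 := Finset.card_filter_add_card_filter_not (s := K) (z ∈ ·)
    rw [hK.card_eq] at h4
    omega
  have hTF : K.filter (z ∉ ·) ⊆ F.erase e₀ := by
    intro e he
    rw [Finset.mem_filter] at he
    refine Finset.mem_erase.2 ⟨?_, hKF e he.1 he.2⟩
    rintro rfl
    have hpe := hB.p_mem he.1
    simp only [Finset.mem_insert, Finset.mem_singleton] at hp
    rcases hp with rfl | rfl | rfl
    · exact hxe hpe
    · exact hye hpe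
    · exact hve hpe
  -- the edges of the opponent in the second copy through the spine vertex `s'`
  set S : Finset (Finset ℕ) := insert {p', q', s', t'}
    ((R'.erase z').image fun r => {p', q', s', r}) with hS
  have hz't : z' ∉ ({p', q', s', t'} : Finset ℕ) := by
    intro h
    simp only [Finset.mem_insert, Finset.mem_singleton] at h
    rcases h with rfl | rfl | rfl | rfl
    · exact hB'.pR hzR'
    · exact hB'.qR hzR'
    · exact hB'.sR hzR'
    · exact hB'.tR hzR'
  have hScard : S.card = 4 := by
    rw [hS, Finset.card_insert_of_notMem, Finset.card_image_of_injOn, Finset.card_erase_of_mem hzR',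
      hB'.card]
    · exact (injOn_insert_three hB'.pR hB'.qR hB'.sR).mono (by
        simp only [Finset.coe_erase]; exact Set.sdiff_subset)
    · intro h
      obtain ⟨r, hr, h⟩ := Finset.mem_image.1 h
      have h3 : t' ∈ ({p', q', s', r} : Finset ℕ) := by rw [h]; simp
      have := hB'.pt
      have := hB'.qt
      have := hB'.st
      have := hB'.tR
      have := (Finset.mem_erase.1 hr).2
      grind
  have hSK : ∀ e ∈ S, e ∈ K' ∧ z' ∉ e ∧ ({x, y, a} : Finset ℕ) ⊆ e := by
    intro e he
    rcases Finset.mem_insert.1 he with rfl | he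
    · refine ⟨hB'.spine_mem, hz't, ?_⟩
      rw [← hpqs']
      grind
    · obtain ⟨r, hr, rfl⟩ := Finset.mem_image.1 he
      rw [Finset.mem_erase] at hr
      refine ⟨hB'.left_mem hr.2, ?_, ?_⟩
      · grind
      · rw [← hpqs']
        grind
  have hSF : S ⊆ F.erase e₀ := by
    intro e he
    obtain ⟨h3, h4, h5⟩ := hSK e he
    refine Finset.mem_erase.2 ⟨?_, hKF' e h3 h4⟩
    rintro rfl
    exact hxe (h5 (by simp))
  -- Seven edges of one copy and four of the other lie among the at most nine edges of `F` other
  -- than `e₀`.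
  have htwo : 1 < (K.filter (z ∉ ·) ∩ S).card := by
    have h3 := Finset.card_union_add_card_inter (K.filter (z ∉ ·)) S
    have h4 := Finset.card_le_card (Finset.union_subset hTF hSF)
    rw [Finset.card_erase_of_mem he₀] at h4
    omega
  obtain ⟨g₁, hg₁, g₂, hg₂, hne⟩ := Finset.one_lt_card.1 htwo
  have hform : ∀ g ∈ K.filter (z ∉ ·) ∩ S, ({x, y, a} : Finset ℕ) ⊆ g ∧
      ∃ r ∈ R, g = {p, q, t, r} := by
    intro g hg
    rw [Finset.mem_inter, Finset.mem_filter] at hg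
    obtain ⟨h3, h4, h5⟩ := hSK g hg.2
    refine ⟨h5, ?_⟩
    -- Otherwise `g` is the spine edge of the core, which the hero owns.
    have hvg : v ∉ g := by
      intro hvg
      have h6 := eq_four (hB.card_edge hg.1.1) (h5 (by simp : x ∈ _)) (h5 (by simp : y ∈ _))
        (h5 (by simp : a ∈ _)) hvg hc.xy hc.xa hc.xv hc.ya hc.yv hc.av
      exact Finset.disjoint_left.1 hKM (h6 ▸ hg.1.1) hc.spine
    have hv : v ∈ ({p, q, s} : Finset ℕ) := by rw [hpqs]; simp
    rcases hB.mem_iff.1 hg.1.1 with rfl | ⟨r, hr, rfl | rfl⟩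
    · grind
    · grind
    · exact ⟨r, hr, rfl⟩
  obtain ⟨hs₁, r₁, hr₁, rfl⟩ := hform g₁ hg₁
  obtain ⟨hs₂, r₂, hr₂, rfl⟩ := hform g₂ hg₂
  have hr : r₁ ≠ r₂ := by
    rintro rfl
    exact hne rfl
  -- The two common edges differ only in their page, so neither page is among `x`, `y`, `a`. It
  -- follows that the spine edge of `K` is that of the core, a contradiction.
  have hsub : ({x, y, a} : Finset ℕ) ⊆ {p, q, t} := by
    intro w hw
    have h3 := hs₁ hw
    have h4 := hs₂ hw
    simp only [Finset.mem_insert, Finset.mem_singleton] at h3 h4 ⊢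
    have := hB.pR
    have := hB.qR
    have := hB.tR
    grind
  have hx3 := hsub (by simp : x ∈ _)
  have hy3 := hsub (by simp : y ∈ _)
  have ha3 := hsub (by simp : a ∈ _)
  have hv3 : v ∈ ({p, q, s} : Finset ℕ) := by rw [hpqs]; simp
  have hfin : ({p, q, s, t} : Finset ℕ) = {x, y, a, v} := by
    refine eq_four (hB.card_edge hB.spine_mem) ?_ ?_ ?_ ?_ hc.xy hc.xa hc.xv hc.ya hc.yv hc.av <;>
      grind
  exact Finset.disjoint_left.1 hKM hB.spine_mem (hfin ▸ hc.spine)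

/-! ### Answering the perpetual threats of the opponent -/

/-- Every page other than `u` costs an edge at `s`. -/
theorem IsBook.three_le_card_sdiff {K F : Finset (Finset ℕ)} {p q s t : ℕ} {R : Finset ℕ}
    (h : IsBook K p q s t R) (u : ℕ) (hu : ∀ r ∈ R, r ≠ u → {p, q, s, r} ∉ F) :
    3 ≤ (K \ F).card := by
  have h1 : 3 ≤ (R.erase u).card := by
    have := Finset.pred_card_le_card_erase (s := R) (a := u)
    rw [h.card] at this
    omega
  rw [← Finset.card_image_of_injOn ((injOn_insert_three h.pR h.qR h.sR).mono
    (by simp only [Finset.coe_erase]; exact Set.sdiff_subset))] at h1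
  refine h1.trans (Finset.card_le_card fun e he => ?_)
  obtain ⟨r, hr, rfl⟩ := Finset.mem_image.1 he
  rw [Finset.mem_erase] at hr
  exact Finset.mem_sdiff.2 ⟨h.left_mem hr.2, hu r hr.2 hr.1⟩

/-- At least two pages differ from `u` and `u'`, and each of them lacks both of its edges; three of
these four edges are counted. -/
theorem IsBook.three_le_card_sdiff' {K F : Finset (Finset ℕ)} {p q s t : ℕ} {R : Finset ℕ}
    (h : IsBook K p q s t R) (u u' : ℕ)
    (hu : ∀ r ∈ R, r ≠ u → r ≠ u' → {p, q, s, r} ∉ F ∧ {p, q, t, r} ∉ F) :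
    3 ≤ (K \ F).card := by
  have h1 : 1 < ((R.erase u).erase u').card := by
    have h2 := Finset.pred_card_le_card_erase (s := R) (a := u)
    have h3 := Finset.pred_card_le_card_erase (s := R.erase u) (a := u')
    rw [h.card] at h2
    omega
  obtain ⟨r₁, hr₁, r₂, hr₂, hne⟩ := Finset.one_lt_card.1 h1
  simp only [Finset.mem_erase] at hr₁ hr₂
  obtain ⟨h1, h2, h3⟩ := hr₁
  obtain ⟨h4, h5, h6⟩ := hr₂
  have hsub : ({{p, q, s, r₁}, {p, q, s, r₂}, {p, q, t, r₁}} : Finset (Finset ℕ)) ⊆ K \ F := by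
    intro e he
    simp only [Finset.mem_insert, Finset.mem_singleton] at he
    rcases he with rfl | rfl | rfl
    · exact Finset.mem_sdiff.2 ⟨h.left_mem h3, (hu _ h3 h2 h1).1⟩
    · exact Finset.mem_sdiff.2 ⟨h.left_mem h6, (hu _ h6 h5 h4).1⟩
    · exact Finset.mem_sdiff.2 ⟨h.right_mem h3, (hu _ h3 h2 h1).2⟩
  have hs : ∀ r ∈ R, s ∉ ({p, q, t, r} : Finset ℕ) := by
    intro r hr hs
    simp only [Finset.mem_insert, Finset.mem_singleton] at hs
    rcases hs with hs | hs | hs | rfl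
    · exact h.ps hs.symm
    · exact h.qs hs.symm
    · exact h.st hs
    · exact h.sR hr
  have h7 : ({{p, q, s, r₁}, {p, q, s, r₂}, {p, q, t, r₁}} : Finset (Finset ℕ)).card = 3 := by
    refine Finset.card_eq_three.2 ⟨_, _, _, ?_, ?_, ?_, rfl⟩
    · exact fun h' => hne (injOn_insert_three h.pR h.qR h.sR h3 h6 h')
    · intro h'
      exact hs r₁ h3 (by rw [← h']; simp)
    · intro h'
      exact hs r₁ h3 (by rw [← h']; simp)
  exact h7 ▸ Finset.card_le_card hsub

/-- `F` consists of edges through `p` and `q` which meet `{A, B}`, and of at most two further edges,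
which avoid `p` and `q`. -/
structure DoubleStar (F : Finset (Finset ℕ)) (p q A B : ℕ) (X : Finset (Finset ℕ)) : Prop where
  pq : p ≠ q
  mem : ∀ e ∈ F, e ∈ X ∨ (p ∈ e ∧ q ∈ e ∧ (A ∈ e ∨ B ∈ e))
  card : X.card ≤ 2
  avoid : ∀ e ∈ X, p ∉ e ∧ q ∉ e

namespace DoubleStar

variable {F K : Finset (Finset ℕ)} {p q A B : ℕ} {X : Finset (Finset ℕ)}

theorem swap (h : DoubleStar F p q A B X) : DoubleStar F q p A B X where
  pq := h.pq.symm
  mem e he := (h.mem e he).imp id fun h => ⟨h.2.1, h.1, h.2.2⟩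
  card := h.card
  avoid e he := (h.avoid e he).symm

/-- An edge of `K` that contains `p` and `q` besides its centres is `{p', q', p, q}`; all others
come from `X`. -/
theorem card_inter_le (h : DoubleStar F p q A B X) {p' q' s t : ℕ} {R : Finset ℕ}
    (hB : IsBook K p' q' s t R) (hpp : p ≠ p') (hpq : p ≠ q') (hqp : q ≠ p') (hqq : q ≠ q') :
    (K ∩ F).card ≤ 3 := by
  have hsub : K ∩ F ⊆ insert {p', q', p, q} X := by
    intro e he
    rw [Finset.mem_inter] at he
    rcases h.mem e he.2 with h' | ⟨h1, h2, -⟩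
    · exact Finset.mem_insert_of_mem h'
    · rw [eq_four (hB.card_edge he.1) (hB.p_mem he.1) (hB.q_mem he.1) h1 h2 hB.pq hpp.symm
        hqp.symm hpq.symm hqq.symm h.pq]
      exact Finset.mem_insert_self _ _
  have := (Finset.card_le_card hsub).trans (Finset.card_insert_le _ _)
  have := h.card
  omega

/-- The edges of `X` avoid the centre `p`, so all edges of `K ∩ F` contain `q`. If `q` is no centre,
some spine vertex differs from `q`, and an edge from it to a page contains `q` only if that page is
`q`. -/
theorem centre_eq (h : DoubleStar F p q A B X) {q' s t : ℕ} {R : Finset ℕ}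
    (hB : IsBook K p q' s t R) (hcard : (K \ F).card ≤ 2) : q = q' := by
  by_contra hne
  have hmem : ∀ e ∈ K, e ∈ F → q ∈ e := by
    intro e he heF
    rcases h.mem e heF with h' | h'
    · exact absurd (hB.p_mem he) (h.avoid e h').1
    · exact h'.2.1
  have key : ∀ s t, IsBook K p q' s t R → q ≠ s → 3 ≤ (K \ F).card := by
    intro s t hB hs
    refine hB.three_le_card_sdiff q fun r hr hrq hF => ?_
    have := hmem _ (hB.left_mem hr) hF
    simp only [Finset.mem_insert, Finset.mem_singleton] at this
    rcases this with h' | h' | h' | h'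
    · exact h.pq h'.symm
    · exact hne h'
    · exact hs h'
    · exact hrq h'.symm
  by_cases hs : q = s
  · have := key t s hB.swapSpine (fun h' => hB.st (hs.symm.trans h'))
    omega
  · have := key s t hB hs
    omega

/-- If `s` is neither `A` nor `B`, an edge `{p, q, s, r}` of `F` needs `r` in `{A, B}`. When `t` is
one of these two, `r` can only be the other one, and three edges at `s` are missing. Otherwise two
pages lack both of their edges. -/
theorem spine_mem (h : DoubleStar F p q A B X) {s t : ℕ} {R : Finset ℕ}
    (hB : IsBook K p q s t R) (hA : A ≠ p ∧ A ≠ q) (hBB : B ≠ p ∧ B ≠ q)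
    (hcard : (K \ F).card ≤ 2) : s = A ∨ s = B := by
  by_contra! hne
  have hmem : ∀ e ∈ K, e ∈ F → A ∈ e ∨ B ∈ e := by
    intro e he heF
    rcases h.mem e heF with h' | h'
    · exact absurd (hB.p_mem he) (h.avoid e h').1
    · exact h'.2.2
  have key : ∀ u v w : ℕ, u ≠ p → u ≠ q → v ≠ u → w ≠ u → u ∉ ({p, q, v, w} : Finset ℕ) := by
    intro u v w h1 h2 h3 h4 h5
    simp only [Finset.mem_insert, Finset.mem_singleton] at h5
    rcases h5 with h5 | h5 | h5 | h5
    · exact h1 h5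
    · exact h2 h5
    · exact h3 h5.symm
    · exact h4 h5.symm
  have hR : ∀ r ∈ R, r ≠ t := by
    rintro r hr rfl
    exact hB.tR hr
  by_cases htA : t = A
  · have := hB.three_le_card_sdiff (F := F) B fun r hr hrB hF => by
      rcases hmem _ (hB.left_mem hr) hF with h' | h'
      · exact key A s r hA.1 hA.2 hne.1 (htA ▸ hR r hr) h'
      · exact key B s r hBB.1 hBB.2 hne.2 hrB h'
    omega
  by_cases htB : t = B
  · have := hB.three_le_card_sdiff (F := F) A fun r hr hrA hF => by
      rcases hmem _ (hB.left_mem hr) hF with h' | h'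
      · exact key A s r hA.1 hA.2 hne.1 hrA h'
      · exact key B s r hBB.1 hBB.2 hne.2 (htB ▸ hR r hr) h'
    omega
  have := hB.three_le_card_sdiff' (F := F) A B fun r hr hrA hrB => by
    constructor
    · intro hF
      rcases hmem _ (hB.left_mem hr) hF with h' | h'
      · exact key A s r hA.1 hA.2 hne.1 hrA h'
      · exact key B s r hBB.1 hBB.2 hne.2 hrB h'
    · intro hF
      rcases hmem _ (hB.right_mem hr) hF with h' | h'
      · exact key A t r hA.1 hA.2 htA hrA h'
      · exact key B t r hBB.1 hBB.2 htB hrB h'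
  omega

/-- All copies which the opponent nearly owns have the same centres and the same spine. -/
theorem isBook (h : DoubleStar F p q A B X) (hA : A ≠ p ∧ A ≠ q) (hBB : B ≠ p ∧ B ≠ q)
    (hK : IsCopy K) (hcard : (K \ F).card ≤ 2) : ∃ R, IsBook K p q A B R := by
  have key : ∀ q' s t R, IsBook K p q' s t R → ∃ R, IsBook K p q A B R := by
    intro q' s t R hB
    obtain rfl := h.centre_eq hB hcard
    have hs := h.spine_mem hB hA hBB hcard
    have ht := h.spine_mem hB.swapSpine hA hBB hcard
    rcases hs with rfl | rfl <;> rcases ht with rfl | rfl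
    · exact absurd rfl hB.st
    · exact ⟨R, hB⟩
    · exact ⟨R, hB.swapSpine⟩
    · exact absurd rfl hB.st
  obtain ⟨p', q', s, t, R, hB⟩ := hK
  by_cases hpp : p = p'
  · subst hpp
    exact key _ _ _ _ hB
  by_cases hpq : p = q'
  · subst hpq
    exact key _ _ _ _ hB.swapCentre
  by_cases hqp : q = p'
  · subst hqp
    exact absurd (h.swap.centre_eq hB hcard) hpq
  by_cases hqq : q = q'
  · subst hqq
    exact absurd (h.swap.centre_eq hB.swapCentre hcard) hpp
  · have h1 := h.card_inter_le hB hpp hpq hqp hqq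
    have h2 := Finset.card_sdiff_add_card_inter K F
    rw [hB.card_eq] at h2
    omega

end DoubleStar

/-- The opponent, who is to move, can only threaten with the spine `A`, `B`, with one new page at a
time. -/
structure Perpetual (M F : Finset (Finset ℕ)) (p q A B : ℕ) (X : Finset (Finset ℕ))
    (Q : Finset ℕ) : Prop where
  star : DoubleStar F p q A B X
  hA : A ≠ p ∧ A ≠ q
  hB : B ≠ p ∧ B ≠ q
  disj : Disjoint F M
  dead : {p, q, A, B} ∈ M ∨ (Q.card ≤ 3 ∧ ∀ C, C ∉ Q → C ≠ A → C ≠ B →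
    ({p, q, A, C} ∈ F ∨ {p, q, B, C} ∈ F) → ({p, q, A, C} ∈ M ∨ {p, q, B, C} ∈ M))

namespace Perpetual

variable {M F K : Finset (Finset ℕ)} {p q A B : ℕ} {X : Finset (Finset ℕ)} {Q : Finset ℕ}

/-- Four pages do not fit into `Q`, and by `dead` the opponent owns no edge at a page `C` outside
`Q` in a copy that is still possible. Both edges at `C` are thus missing, and `e` must be one of
them. -/
theorem exists_page (h : Perpetual M F p q A B X Q) {e : Finset ℕ} (hK : IsCopy K)
    (hKM : Disjoint K M) (hcard : (K \ insert e F).card ≤ 1) :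
    ∃ C, C ≠ p ∧ C ≠ q ∧ C ≠ A ∧ C ≠ B ∧ {p, q, A, C} ∈ K ∧ {p, q, B, C} ∈ K ∧
      {p, q, A, C} ∉ F ∧ {p, q, B, C} ∉ F ∧ (e = {p, q, A, C} ∨ e = {p, q, B, C}) ∧
      {p, q, A, B} ∉ M := by
  have hsub : K \ F ⊆ insert e (K \ insert e F) := by
    intro g hg
    simp only [Finset.mem_sdiff, Finset.mem_insert] at hg ⊢
    tauto
  have h2 : (K \ F).card ≤ 2 := by
    have := (Finset.card_le_card hsub).trans (Finset.card_insert_le _ _)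
    omega
  obtain ⟨R, hB⟩ := h.star.isBook h.hA h.hB hK h2
  have hspine : {p, q, A, B} ∉ M := Finset.disjoint_left.1 hKM hB.spine_mem
  obtain ⟨hQ, hdead⟩ := h.dead.resolve_left hspine
  obtain ⟨C, hC, hCQ⟩ : ∃ C ∈ R, C ∉ Q := by
    by_contra! hcon
    have := Finset.card_le_card (s := R) (t := Q) hcon
    rw [hB.card] at this
    omega
  have hCp : C ≠ p := fun h => hB.pR (h ▸ hC)
  have hCq : C ≠ q := fun h => hB.qR (h ▸ hC)
  have hCA : C ≠ A := fun h => hB.sR (h ▸ hC)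
  have hCB : C ≠ B := fun h => hB.tR (h ▸ hC)
  have hFF : ¬ ({p, q, A, C} ∈ F ∨ {p, q, B, C} ∈ F) := by
    intro h'
    rcases hdead C hCQ hCA hCB h' with h' | h'
    · exact Finset.disjoint_left.1 hKM (hB.left_mem hC) h'
    · exact Finset.disjoint_left.1 hKM (hB.right_mem hC) h'
  push Not at hFF
  have hne : ({p, q, A, C} : Finset ℕ) ≠ {p, q, B, C} := by
    intro h'
    have hm : A ∈ ({p, q, B, C} : Finset ℕ) := by rw [← h']; simp
    simp only [Finset.mem_insert, Finset.mem_singleton] at hm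
    rcases hm with hm | hm | hm | hm
    · exact h.hA.1 hm
    · exact h.hA.2 hm
    · exact hB.st hm
    · exact hCA hm.symm
  refine ⟨C, hCp, hCq, hCA, hCB, hB.left_mem hC, hB.right_mem hC, hFF.1, hFF.2, ?_, hspine⟩
  by_contra! hcon
  refine hne (Finset.card_le_one.1 hcard _ ?_ _ ?_)
  · simp only [Finset.mem_sdiff, Finset.mem_insert, not_or]
    exact ⟨hB.left_mem hC, hcon.1.symm, hFF.1⟩
  · simp only [Finset.mem_sdiff, Finset.mem_insert, not_or]
    exact ⟨hB.right_mem hC, hcon.2.symm, hFF.2⟩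

/-- One move cannot supply both edges at the untouched page. -/
theorem not_hasBook (h : Perpetual M F p q A B X Q) {e : Finset ℕ} (he : e ∉ M) :
    ¬ HasBook (insert e F) := by
  rintro ⟨K, hK, hKF⟩
  have hKM : Disjoint K M := by
    rw [Finset.disjoint_left]
    intro g hg hgM
    rcases Finset.mem_insert.1 (hKF hg) with rfl | hgF
    · exact he hgM
    · exact Finset.disjoint_left.1 h.disj hgF hgM
  obtain ⟨C, hCp, hCq, hCA, hCB, h1, h2, h3, h4, h5, h6⟩ := h.exists_page (e := e) hK hKM (by
    rw [Finset.sdiff_eq_empty_iff_subset.2 hKF]; simp)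
  have h7 := (Finset.mem_insert.1 (hKF h1)).resolve_right h3
  have h8 := (Finset.mem_insert.1 (hKF h2)).resolve_right h4
  have hAB : A ≠ B := by
    rintro rfl
    obtain ⟨R, hB⟩ := h.star.isBook h.hA h.hB hK (by
      have hsub : K \ F ⊆ {e} := by
        intro g hg
        rw [Finset.mem_sdiff] at hg
        exact Finset.mem_singleton.2 ((Finset.mem_insert.1 (hKF hg.1)).resolve_right hg.2)
      have := Finset.card_le_card hsub
      simp only [Finset.card_singleton] at this
      omega)
    exact hB.st rfl
  have hm : A ∈ ({p, q, B, C} : Finset ℕ) := by rw [h8, ← h7]; simp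
  simp only [Finset.mem_insert, Finset.mem_singleton] at hm
  rcases hm with hm | hm | hm | hm
  · exact h.hA.1 hm
  · exact h.hA.2 hm
  · exact hAB hm
  · exact hCA hm.symm

/-- Every threat can be answered. -/
theorem exists_answer (h : Perpetual M F p q A B X Q) {e : Finset ℕ} (he : e ∉ M) (hK : IsCopy K)
    (hKM : Disjoint K M) (hcard : (K \ insert e F).card ≤ 1) :
    ∃ g, g.card = 4 ∧ g ∉ M ∧ g ∉ insert e F ∧
      Perpetual (insert g M) (insert e F) p q A B X Q := by
  have hno := h.not_hasBook he
  obtain ⟨C, hCp, hCq, hCA, hCB, h1, h2, h3, h4, h5, h6⟩ := h.exists_page hK hKM hcard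
  have hQ := h.dead.resolve_left h6
  obtain ⟨g, hg⟩ : ∃ g, g ∈ K \ insert e F := by
    by_contra! hcon
    exact hno ⟨K, hK, Finset.sdiff_eq_empty_iff_subset.1 (Finset.eq_empty_of_forall_notMem hcon)⟩
  have hKg := Finset.mem_sdiff.1 hg
  have hfour : (({p, q, A, C} : Finset ℕ) = g ∨ {p, q, A, C} = e) ∧
      (({p, q, B, C} : Finset ℕ) = g ∨ {p, q, B, C} = e) := by
    constructor
    · by_cases h' : ({p, q, A, C} : Finset ℕ) = e
      · exact Or.inr h'
      · refine Or.inl (Finset.card_le_one.1 hcard _ ?_ _ hg)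
        simp only [Finset.mem_sdiff, Finset.mem_insert, not_or]
        exact ⟨h1, h', h3⟩
    · by_cases h' : ({p, q, B, C} : Finset ℕ) = e
      · exact Or.inr h'
      · refine Or.inl (Finset.card_le_one.1 hcard _ ?_ _ hg)
        simp only [Finset.mem_sdiff, Finset.mem_insert, not_or]
        exact ⟨h2, h', h4⟩
  have hgM : g ∉ M := Finset.disjoint_left.1 hKM hKg.1
  have hcardg := hK.card_edge hKg.1
  have heK : p ∈ e ∧ q ∈ e ∧ (A ∈ e ∨ B ∈ e) := by
    rcases h5 with rfl | rfl <;> simp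
  have hpage : ∀ C', C' ≠ A → C' ≠ B → ({p, q, A, C'} = e ∨ {p, q, B, C'} = e) → C' = C := by
    intro C' hA' hB' h'
    have hCe : C ∈ e := by rcases h5 with rfl | rfl <;> simp
    have : C ∈ ({p, q, A, C'} : Finset ℕ) ∨ C ∈ ({p, q, B, C'} : Finset ℕ) := by
      rcases h' with h' | h'
      · exact Or.inl (h' ▸ hCe)
      · exact Or.inr (h' ▸ hCe)
    simp only [Finset.mem_insert, Finset.mem_singleton, hCp, hCq, hCA, hCB, false_or] at this
    exact this.elim Eq.symm Eq.symm
  have hgAB : g = {p, q, A, C} ∨ g = {p, q, B, C} := by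
    have hge : g ≠ e := fun h' => hKg.2 (h' ▸ Finset.mem_insert_self _ _)
    by_contra! hcon
    have ha := hfour.1.resolve_left hcon.1.symm
    have hb := hfour.2.resolve_left hcon.2.symm
    have hAB : A ≠ B := by
      rintro rfl
      have hsub : K \ F ⊆ insert e (K \ insert e F) := by
        intro g hg
        simp only [Finset.mem_sdiff, Finset.mem_insert] at hg ⊢
        tauto
      have := (Finset.card_le_card hsub).trans (Finset.card_insert_le _ _)
      obtain ⟨R, hB⟩ := h.star.isBook h.hA h.hB hK (by omega)
      exact hB.st rfl
    have hm : A ∈ ({p, q, B, C} : Finset ℕ) := by rw [hb, ← ha]; simp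
    simp only [Finset.mem_insert, Finset.mem_singleton] at hm
    rcases hm with hm | hm | hm | hm
    · exact h.hA.1 hm
    · exact h.hA.2 hm
    · exact hAB hm
    · exact hCA hm.symm
  -- The answer `g` is the second edge at the page `C`. It makes `C` satisfy `dead`, so `Q` stays
  -- the same.
  refine ⟨g, hcardg, hgM, hKg.2, ⟨h.star.pq, ?_, h.star.card, h.star.avoid⟩, h.hA, h.hB, ?_,
    Or.inr ⟨hQ.1, ?_⟩⟩
  · intro f hf
    rcases Finset.mem_insert.1 hf with rfl | hf
    · exact Or.inr heK
    · exact h.star.mem f hf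
  · rw [Finset.disjoint_insert_right, Finset.disjoint_insert_left]
    exact ⟨hKg.2, he, h.disj⟩
  · intro C' hC'Q hA' hB' h'
    by_cases hF : {p, q, A, C'} ∈ F ∨ {p, q, B, C'} ∈ F
    · exact (hQ.2 C' hC'Q hA' hB' hF).imp (Finset.mem_insert_of_mem) (Finset.mem_insert_of_mem)
    · push Not at hF
      have h'' := h'.imp (fun h' => (Finset.mem_insert.1 h').resolve_right hF.1)
        (fun h' => (Finset.mem_insert.1 h').resolve_right hF.2)
      obtain rfl := hpage C' hA' hB' h''
      rcases hgAB with rfl | rfl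
      · exact Or.inl (Finset.mem_insert_self _ _)
      · exact Or.inr (Finset.mem_insert_self _ _)

/-- Threats are answered as they come; at the first pause the core takes over. A copy through `{x,
y, v, z}` has its centres outside `e₀`, hence different from `p` and `q`, and so contains at most
three edges of `F`. -/
theorem safe (h : Perpetual M F p q A B X Q) {x y a v : ℕ} {Q' : Finset ℕ}
    (hc : Core M x y a v Q') {e₀ : Finset ℕ} (he₀ : e₀ ∈ F) (hp : p ∈ e₀) (hq : q ∈ e₀)
    (hdisj : Disjoint e₀ {x, y, a, v}) {e : Finset ℕ} (heM : e ∉ M) :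
    Safe M (insert e F) := by
  refine Safe.coind (fun M' F' => M ⊆ M' ∧ ∃ F e, e₀ ∈ F ∧ Perpetual M' F p q A B X Q ∧
    F' = insert e F ∧ e ∉ M') ?_ ⟨subset_rfl, F, e, he₀, h, rfl, heM⟩
  clear! F
  rintro M' F' ⟨hM, F, e, he₀, h, rfl, he⟩
  by_cases hthreat : ∃ K, IsCopy K ∧ Disjoint K M' ∧ (K \ insert e F).card ≤ 1
  · obtain ⟨K, hK, hKM, hcard⟩ := hthreat
    obtain ⟨g, hg1, hg2, hg3, hg4⟩ := h.exists_answer he hK hKM hcard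
    refine Or.inr ⟨g, hg1, hg2, hg3, Or.inr fun e' _ he' => ⟨hg4.not_hasBook he', Or.inl ?_⟩⟩
    exact ⟨hM.trans (Finset.subset_insert _ _), _, e', Finset.mem_insert_of_mem he₀, hg4, rfl,
      he'⟩
  · left
    push Not at hthreat
    refine (hc.mono hM).safe ?_ (fun K hK hKM => hthreat K hK hKM) ?_
    · rw [Finset.disjoint_insert_left]
      exact ⟨he, h.disj⟩
    · intro K z hK hKM hz hzK _
      obtain ⟨p', q', s, t, R, hB⟩ := hK
      have hfar : ∀ w ∈ ({x, y, v, z} : Finset ℕ), w ∉ e₀ := by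
        intro w hw hwe
        simp only [Finset.mem_insert, Finset.mem_singleton] at hw
        rcases hw with rfl | rfl | rfl | rfl
        · exact Finset.disjoint_left.1 hdisj hwe (by simp)
        · exact Finset.disjoint_left.1 hdisj hwe (by simp)
        · exact Finset.disjoint_left.1 hdisj hwe (by simp)
        · exact hz e₀ (Finset.mem_insert_of_mem he₀) hwe
      have hp' := hfar _ (hB.p_mem hzK)
      have hq' := hfar _ (hB.q_mem hzK)
      have h1 := h.star.card_inter_le hB (fun h => hp' (h ▸ hp)) (fun h => hq' (h ▸ hp))
        (fun h => hp' (h ▸ hq)) (fun h => hq' (h ▸ hq))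
      have h2 := Finset.card_sdiff_add_card_inter K (insert e F)
      have h3 : K ∩ insert e F ⊆ insert e (K ∩ F) := by
        intro g hg
        simp only [Finset.mem_inter, Finset.mem_insert] at hg ⊢
        tauto
      have h4 := (Finset.card_le_card h3).trans (Finset.card_insert_le _ _)
      rw [hB.card_eq] at h2
      omega

end Perpetual

/-! ### From a core to a draw: blocking the one threat, and counting lost edges. -/

/-- The owner of a core, who is to move, is safe if every threat of the opponent comes from a copy
through a fixed edge far from the core that contains nearly all edges of the opponent. -/
theorem Core.safe_of_threats {M F : Finset (Finset ℕ)} {x y a v : ℕ} {Q : Finset ℕ}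
    (hc : Core M x y a v Q) (hd : Disjoint F M) (hF : F.card ≤ 10) {e₀ : Finset ℕ} (he₀ : e₀ ∈ F)
    (hdisj : Disjoint e₀ {x, y, a, v})
    (hT : ∀ K, IsCopy K → Disjoint K M → (K \ F).card ≤ 1 → e₀ ∈ K ∧ (K \ F).card = 1 ∧
      (F \ K).card ≤ 2 ∧ ∀ e ∈ F \ K, Disjoint e e₀) : ¬ HasBook F ∧ Safe M F := by
  have hno : ¬ HasBook F := by
    rintro ⟨K, hK, hKF⟩
    have hempty := Finset.sdiff_eq_empty_iff_subset.2 hKF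
    have := (hT K hK (hd.mono_left hKF) (by simp [hempty])).2.1
    simp [hempty] at this
  refine ⟨hno, ?_⟩
  by_cases hthreat : ∃ K, IsCopy K ∧ Disjoint K M ∧ (K \ F).card ≤ 1
  · obtain ⟨K, hK, hKM, hcard⟩ := hthreat
    obtain ⟨h1, h2, h3, h4⟩ := hT K hK hKM hcard
    obtain ⟨g, hg⟩ := Finset.card_eq_one.1 h2
    have hgK := Finset.mem_sdiff.1 (hg ▸ Finset.mem_singleton_self g : g ∈ K \ F)
    have hgM := Finset.disjoint_left.1 hKM hgK.1
    obtain ⟨p, q, s, t, R, hB⟩ := hK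
    have hper : ∃ Q, Perpetual (insert g M) F p q s t (F \ K) Q := by
      have hstar : DoubleStar F p q s t (F \ K) := by
        refine ⟨hB.pq, fun e he => ?_, h3, fun e he => ?_⟩
        · by_cases heK : e ∈ K
          · exact Or.inr ⟨hB.p_mem heK, hB.q_mem heK, hB.s_or_t_mem heK⟩
          · exact Or.inl (Finset.mem_sdiff.2 ⟨he, heK⟩)
        · exact ⟨fun h => Finset.disjoint_left.1 (h4 e he) h (hB.p_mem h1),
            fun h => Finset.disjoint_left.1 (h4 e he) h (hB.q_mem h1)⟩
      have hd' : Disjoint F (insert g M) := by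
        rw [Finset.disjoint_insert_right]
        exact ⟨hgK.2, hd⟩
      rcases hB.mem_iff.1 hgK.1 with hsp | ⟨C, hC, hCg⟩
      · refine ⟨∅, hstar, ⟨hB.ps.symm, hB.qs.symm⟩, ⟨hB.pt.symm, hB.qt.symm⟩, hd', Or.inl ?_⟩
        rw [← hsp]
        exact Finset.mem_insert_self _ _
      -- Every edge of `F` through `p` lies in `K`, so a page outside `R` is untouched. The only
      -- other page outside `R.erase C` is `C`, where the hero now owns `g`.
      · refine ⟨R.erase C, hstar, ⟨hB.ps.symm, hB.qs.symm⟩, ⟨hB.pt.symm, hB.qt.symm⟩, hd',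
          Or.inr ⟨?_, ?_⟩⟩
        · rw [Finset.card_erase_of_mem hC, hB.card]
        · intro C' hC' hs ht h'
          obtain rfl : C' = C := by
            by_contra hne
            have hC'R : C' ∉ R := fun h => hC' (Finset.mem_erase.2 ⟨hne, h⟩)
            have key : ∀ e ∈ F, p ∈ e → C' ∈ e → C' ≠ p → C' ≠ q → False := by
              intro e he hpe hCe hp hq
              by_cases heK : e ∈ K
              · exact hC'R (hB.mem_pages heK hCe hp hq hs ht)
              · exact (hstar.avoid e (Finset.mem_sdiff.2 ⟨he, heK⟩)).1 hpe
            have hcard4 : ∀ e ∈ F, p ∈ e → e.card = 4 := by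
              intro e he hpe
              by_cases heK : e ∈ K
              · exact hB.card_edge heK
              · exact absurd hpe (hstar.avoid e (Finset.mem_sdiff.2 ⟨he, heK⟩)).1
            rcases h' with h' | h'
            · obtain ⟨-, -, h5, -, h6, -⟩ := ne_of_card_four (hcard4 _ h' (by simp))
              exact key _ h' (by simp) (by simp) h5.symm h6.symm
            · obtain ⟨-, -, h5, -, h6, -⟩ := ne_of_card_four (hcard4 _ h' (by simp))
              exact key _ h' (by simp) (by simp) h5.symm h6.symm
          rcases hCg with rfl | rfl
          · exact Or.inl (Finset.mem_insert_self _ _)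
          · exact Or.inr (Finset.mem_insert_self _ _)
    obtain ⟨Q', hper⟩ := hper
    refine Safe.step g (hB.card_edge hgK.1) hgM hgK.2 fun e _ heM => ⟨hper.not_hasBook heM, ?_⟩
    exact hper.safe (hc.mono (Finset.subset_insert _ _)) he₀ (hB.p_mem h1) (hB.q_mem h1) hdisj heM
  · push Not at hthreat
    exact hc.safe_of_card hd hF he₀ hdisj fun K hK hKM => hthreat K hK hKM

/-- The owner of a core, who is to move, is safe if the opponent has lost enough time: the edges in
`L` are pairwise incompatible, and incompatible with `e₀` and `e₁`. -/
theorem Core.safe_of_lost {M F G L : Finset (Finset ℕ)} {x y a v : ℕ} {Q : Finset ℕ}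
    (hc : Core M x y a v Q) (hd : Disjoint F M) {e₀ e₁ : Finset ℕ}
    (hF : F = insert e₀ (insert e₁ G)) (hL : L ⊆ G) (hG : G.card ≤ 6 + L.card) (hL2 : L.card ≤ 2)
    (hdisj : Disjoint e₀ {x, y, a, v}) (h₀ : e₀.Nonempty) (hL₀ : ∀ b ∈ L, Disjoint b e₀)
    (hL₁ : ∀ K, IsCopy K → Disjoint K M → ∀ b ∈ L, b ∈ K → e₁ ∉ K)
    (hLL : ∀ K, IsCopy K → Disjoint K M → ∀ b ∈ L, b ∈ K → ∀ b' ∈ L, b' ∈ K → b' = b) :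
    ¬ HasBook F ∧ Safe M F := by
  have hins : ∀ G' : Finset (Finset ℕ), (insert e₀ (insert e₁ G')).card ≤ G'.card + 2 := by
    intro G'
    have h1 := Finset.card_insert_le e₀ (insert e₁ G')
    have h2 := Finset.card_insert_le e₁ G'
    omega
  have he₀F : e₀ ∈ F := by rw [hF]; exact Finset.mem_insert_self _ _
  have he₀L : e₀ ∉ L := by
    intro h
    obtain ⟨w, hw⟩ := h₀
    exact Finset.disjoint_left.1 (hL₀ _ h) hw hw
  refine hc.safe_of_threats hd (by rw [hF]; have := hins G; omega) he₀F hdisj ?_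
  intro K hK hKM hcard
  have h9 := Finset.card_sdiff_add_card_inter K F
  rw [hK.card_eq] at h9
  -- A copy through `b` avoids `e₀`, `e₁` and the rest of `L`, so it has at most `6 + 1` edges in
  -- `F`, while a threat needs eight.
  have hnone : ∀ b ∈ L, b ∉ K := by
    intro b hb hbK
    have hsub : K ∩ F ⊆ G \ (L.erase b) := by
      intro e he
      rw [Finset.mem_inter, hF, Finset.mem_insert, Finset.mem_insert] at he
      rcases he with ⟨heK, rfl | rfl | heG⟩
      · exact absurd (hL₀ b hb) (hK.not_disjoint hbK heK)
      · exact absurd heK (hL₁ K hK hKM b hb hbK)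
      · refine Finset.mem_sdiff.2 ⟨heG, fun h => ?_⟩
        rw [Finset.mem_erase] at h
        exact h.1 (hLL K hK hKM b hb hbK e h.2 heK)
    have h1 := Finset.card_le_card hsub
    rw [Finset.card_sdiff_of_subset ((Finset.erase_subset _ _).trans hL),
      Finset.card_erase_of_mem hb] at h1
    have := Finset.card_pos.2 ⟨b, hb⟩
    omega
  have hsub : K ∩ F ⊆ F \ L := by
    intro e he
    rw [Finset.mem_inter] at he
    exact Finset.mem_sdiff.2 ⟨he.2, fun h => hnone e h he.1⟩
  -- At most eight edges are not lost, so a threatening copy contains every one of them, in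
  -- particular `e₀`.
  have h8 : (F \ L).card ≤ 8 := by
    have h1 : F \ L ⊆ insert e₀ (insert e₁ (G \ L)) := by
      intro e he
      rw [hF] at he
      simp only [Finset.mem_sdiff, Finset.mem_insert] at he ⊢
      tauto
    have h2 := (Finset.card_le_card h1).trans (hins _)
    rw [Finset.card_sdiff_of_subset hL] at h2
    omega
  have heq : K ∩ F = F \ L := Finset.eq_of_subset_of_card_le hsub (by omega)
  have hle := Finset.card_le_card hsub
  have hFK : F \ K ⊆ L := by
    intro e he
    rw [Finset.mem_sdiff] at he
    by_contra heL
    have : e ∈ K ∩ F := by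
      rw [heq]
      exact Finset.mem_sdiff.2 ⟨he.1, heL⟩
    exact he.2 (Finset.mem_inter.1 this).1
  refine ⟨?_, by omega, (Finset.card_le_card hFK).trans hL2, fun e he => hL₀ e (hFK he)⟩
  have : e₀ ∈ K ∩ F := by
    rw [heq]
    exact Finset.mem_sdiff.2 ⟨he₀F, he₀L⟩
  exact (Finset.mem_inter.1 this).1

/-! ### The opening -/

/-- The edge `{x, y, b, c}`. -/
def quad (x y b c : ℕ) : Finset ℕ := {x, y, b, c}

theorem mem_quad {x y b c z : ℕ} : z ∈ quad x y b c ↔ z = x ∨ z = y ∨ z = b ∨ z = c := by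
  simp [quad]

theorem quad_comm (x y b c : ℕ) : quad x y b c = quad x y c b := by
  ext z
  simp only [mem_quad]
  tauto

theorem quad_eq_iff {x y b c d e : ℕ} (hb : b ≠ x ∧ b ≠ y) (hc : c ≠ x ∧ c ≠ y)
    (hd : d ≠ x ∧ d ≠ y) (he : e ≠ x ∧ e ≠ y) :
    quad x y b c = quad x y d e ↔ (b = d ∧ c = e) ∨ (b = e ∧ c = d) := by
  constructor
  · intro h
    have h1 : b ∈ quad x y d e := by rw [← h]; simp [quad]
    have h2 : c ∈ quad x y d e := by rw [← h]; simp [quad]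
    have h3 : d ∈ quad x y b c := by rw [h]; simp [quad]
    have h4 : e ∈ quad x y b c := by rw [h]; simp [quad]
    simp only [mem_quad, hb, hc, hd, he, false_or] at h1 h2 h3 h4
    grind
  · rintro (⟨rfl, rfl⟩ | ⟨rfl, rfl⟩)
    · rfl
    · exact quad_comm _ _ _ _

theorem card_quad {x y b c : ℕ} (hxy : x ≠ y) (hb : b ≠ x ∧ b ≠ y) (hc : c ≠ x ∧ c ≠ y)
    (hbc : b ≠ c) : (quad x y b c).card = 4 :=
  card_four hxy hb.1.symm hc.1.symm hb.2.symm hc.2.symm hbc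

/-- A position of the opening: the hero builds a star with the kernel `x`, `y`, `a`; the opponent owns
`e₀`, `e₁` and the edges in `G`. -/
structure Position (M F G : Finset (Finset ℕ)) (x y a : ℕ) (e₀ e₁ : Finset ℕ) (n : ℕ) : Prop where
  xy : x ≠ y
  ax : a ≠ x ∧ a ≠ y
  hx : x ∉ e₀
  hy : y ∉ e₀
  ha : a ∉ e₀
  card₀ : e₀.card = 4
  card₁ : e₁.card = 4
  good : x ∈ e₁ → y ∈ e₁ → a ∈ e₁
  disj : Disjoint F M
  eq : F = insert e₀ (insert e₁ G)
  card : G.card ≤ n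

/-- The hero owns the star edge at `b`, which is not a vertex of `e₀` and `e₁`. -/
structure Leaf (M : Finset (Finset ℕ)) (x y a : ℕ) (e₀ e₁ : Finset ℕ) (b : ℕ) : Prop where
  ne : b ≠ x ∧ b ≠ y
  ne' : b ≠ a
  h₀ : b ∉ e₀
  h₁ : b ∉ e₁
  mem : quad x y a b ∈ M

theorem Leaf.mono {M M' : Finset (Finset ℕ)} {x y a : ℕ} {e₀ e₁ : Finset ℕ} {b : ℕ}
    (h : Leaf M x y a e₀ e₁ b) (hM : M ⊆ M') : Leaf M' x y a e₀ e₁ b :=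
  { h with mem := hM h.mem }

theorem Leaf.insert {M : Finset (Finset ℕ)} {x y a : ℕ} {e₀ e₁ : Finset ℕ} {b : ℕ}
    (h : Leaf M x y a e₀ e₁ b) (m : Finset ℕ) : Leaf (insert m M) x y a e₀ e₁ b :=
  h.mono (Finset.subset_insert _ _)

namespace Position

variable {M F G : Finset (Finset ℕ)} {x y a : ℕ} {e₀ e₁ : Finset ℕ} {n : ℕ}

theorem quad_disjoint (P : Position M F G x y a e₀ e₁ n) {b c : ℕ} (hb : b ∉ e₀) (hc : c ∉ e₀) :
    Disjoint (quad x y b c) e₀ := by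
  rw [Finset.disjoint_left]
  intro z hz
  rcases mem_quad.1 hz with rfl | rfl | rfl | rfl
  · exact P.hx
  · exact P.hy
  · exact hb
  · exact hc

theorem mem_of_mem (P : Position M F G x y a e₀ e₁ n) {b c : ℕ} (hb : Leaf M x y a e₀ e₁ b)
    (h : quad x y b c ∈ F) : quad x y b c ∈ G := by
  rw [P.eq, Finset.mem_insert, Finset.mem_insert] at h
  rcases h with h | h | h
  · exact absurd (h ▸ mem_quad.2 (Or.inl rfl)) P.hx
  · exact absurd (h ▸ mem_quad.2 (Or.inr (Or.inr (Or.inl rfl)))) hb.h₁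
  · exact h

theorem card_le (P : Position M F G x y a e₀ e₁ n) : F.card ≤ n + 2 := by
  have h1 := Finset.card_insert_le e₀ (insert e₁ G)
  have h2 := Finset.card_insert_le e₁ G
  have h3 := P.card
  rw [P.eq]
  omega

theorem not_hasBook (P : Position M F G x y a e₀ e₁ n) (hn : n ≤ 6) : ¬ HasBook F :=
  not_hasBook_of_card (by have := P.card_le; omega)

/-- With at most nine edges the opponent would need all of them in one copy, but `e₀` and `quad x y
b c` are disjoint. -/
theorem not_hasBook_of_mem (P : Position M F G x y a e₀ e₁ n) (hn : n ≤ 7) {b c : ℕ}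
    (hb : Leaf M x y a e₀ e₁ b) (hc : Leaf M x y a e₀ e₁ c) (h : quad x y b c ∈ G) :
    ¬ HasBook F := by
  rintro ⟨K, hK, hKF⟩
  have h1 := P.card_le
  have h2 := Finset.eq_of_subset_of_card_le hKF (by rw [hK.card_eq]; omega)
  refine hK.not_disjoint (e := quad x y b c) (e' := e₀) ?_ ?_ (P.quad_disjoint hb.h₀ hc.h₀)
  · rw [h2, P.eq]
    exact Finset.mem_insert_of_mem (Finset.mem_insert_of_mem h)
  · rw [h2, P.eq]
    exact Finset.mem_insert_self _ _

theorem play (P : Position M F G x y a e₀ e₁ n) {b c : ℕ} (hb : b ≠ x ∧ b ≠ y)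
    (hc : c ≠ x ∧ c ≠ y) (hbc : b ≠ c) (hM : quad x y b c ∉ M) (hF : quad x y b c ∉ F)
    (h : ∀ e : Finset ℕ, Position (insert (quad x y b c) M) (insert e F) (insert e G)
      x y a e₀ e₁ (n + 1) →
      ¬ HasBook (insert e F) ∧ Safe (insert (quad x y b c) M) (insert e F)) : Safe M F := by
  refine Safe.step _ (card_quad P.xy hb hc hbc) hM hF fun e _ he => h e ?_
  refine { P with disj := ?_, eq := ?_, card := ?_ }
  · rw [Finset.disjoint_insert_left, Finset.disjoint_insert_right]
    exact ⟨he, hF, P.disj⟩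
  · rw [P.eq, Finset.insert_comm e e₀, Finset.insert_comm e e₁]
  · exact (Finset.card_insert_le _ _).trans (Nat.succ_le_succ P.card)

/-! ### Why edges of the opponent between leaves are lost. -/

/-- An edge between leaves is incompatible with `e₁`. -/
theorem notMem_of_quad_mem (P : Position M F G x y a e₀ e₁ n) {K : Finset (Finset ℕ)}
    (hK : IsCopy K) (hKM : Disjoint K M) {b c : ℕ} (hb : Leaf M x y a e₀ e₁ b)
    (hc : Leaf M x y a e₀ e₁ c) (h : quad x y b c ∈ K) : e₁ ∉ K := by
  intro he
  obtain ⟨p, q, s, t, R, hB⟩ := hK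
  -- The centres of `K` are common vertices of both edges. As leaves avoid `e₁`, they are `x` and
  -- `y`, and `good` gives `a ∈ e₁`.
  have hcentre : ∀ z ∈ e₁, z ∈ quad x y b c → z = x ∨ z = y := by
    intro z hz hz'
    rcases mem_quad.1 hz' with h' | h' | rfl | rfl
    · exact Or.inl h'
    · exact Or.inr h'
    · exact absurd hz hb.h₁
    · exact absurd hz hc.h₁
  have hp := hcentre p (hB.p_mem he) (hB.p_mem h)
  have hq := hcentre q (hB.q_mem he) (hB.q_mem h)
  have hpq := hB.pq
  have hxe : x ∈ e₁ := by
    rcases hp with rfl | rfl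
    · exact hB.p_mem he
    · rcases hq with rfl | rfl
      · exact hB.q_mem he
      · exact absurd rfl hpq
  have hye : y ∈ e₁ := by
    rcases hp with rfl | rfl
    · rcases hq with rfl | rfl
      · exact absurd rfl hpq
      · exact hB.q_mem he
    · exact hB.p_mem he
  have hae := P.good hxe hye
  have hquad : ∀ u v, quad p q u v = quad x y u v := by
    intro u v
    rcases hp with rfl | rfl <;> rcases hq with rfl | rfl
    · exact absurd rfl hpq
    · rfl
    · simp only [quad, Finset.insert_comm]
    · exact absurd rfl hpq
  -- The spine vertex `t` outside `e₁` is one of the leaves `b`, `c`. Since `a ∈ e₁`, `a` is the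
  -- other spine vertex or a page; either way `K` contains `{x, y, a, t}`, an edge of the hero.
  have key : ∀ s t, IsBook K p q s t R → s ∈ e₁ → t ∉ e₁ → False := by
    intro s t hB hs ht
    have hsp : s ≠ x ∧ s ≠ y ∧ t ≠ x ∧ t ≠ y := by
      have h1 := hB.ps
      have h2 := hB.qs
      have h3 := hB.pt
      have h4 := hB.qt
      grind
    have hsq : s ∉ quad x y b c := fun h' => by
      rcases hcentre s hs h' with h' | h'
      · exact hsp.1 h'
      · exact hsp.2.1 h'
    have htbc : t = b ∨ t = c := by
      have := (hB.s_or_t_mem h).resolve_left hsq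
      rw [mem_quad] at this
      grind
    have htM : quad x y a t ∈ M := by
      rcases htbc with rfl | rfl
      · exact hb.mem
      · exact hc.mem
    by_cases hsa : s = a
    · subst hsa
      have h1 := hB.spine_mem
      change quad p q s t ∈ K at h1
      rw [hquad] at h1
      exact Finset.disjoint_left.1 hKM h1 htM
    · have hta : a ≠ t := fun h' => ht (h' ▸ hae)
      have haR : a ∈ R := by
        refine hB.mem_pages he hae ?_ ?_ (Ne.symm hsa) hta
        · rcases hp with rfl | rfl
          · exact P.ax.1
          · exact P.ax.2
        · rcases hq with rfl | rfl
          · exact P.ax.1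
          · exact P.ax.2
      have h1 := hB.right_mem haR
      change quad p q t a ∈ K at h1
      rw [hquad, quad_comm] at h1
      exact Finset.disjoint_left.1 hKM h1 htM
  by_cases hs : s ∈ e₁
  · refine key s t hB hs fun ht => ?_
    have h1 : ({p, q, s, t} : Finset ℕ) = e₁ := (eq_four P.card₁ (hB.p_mem he) (hB.q_mem he) hs ht
      hB.pq hB.ps hB.pt hB.qs hB.qt hB.st).symm
    rcases hB.s_or_t_mem h with h' | h'
    · have := hcentre s hs h'
      have h2 := hB.ps
      have h3 := hB.qs
      grind
    · have := hcentre t ht h'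
      have h2 := hB.pt
      have h3 := hB.qt
      grind
  · exact key t s hB.swapSpine ((hB.s_or_t_mem he).resolve_left hs) hs

/-- Two disjoint edges between leaves are incompatible if the hero owns the right edges. -/
theorem notMem_of_quad_mem_of_quad_mem (P : Position M F G x y a e₀ e₁ n) {K : Finset (Finset ℕ)}
    (hK : IsCopy K) (hKM : Disjoint K M) {u v w t : ℕ} (hu : Leaf M x y a e₀ e₁ u)
    (hv : Leaf M x y a e₀ e₁ v) (hw : Leaf M x y a e₀ e₁ w) (ht : Leaf M x y a e₀ e₁ t)
    (huv : u ≠ v) (hut : u ≠ t) (hvw : v ≠ w) (hwt : w ≠ t) (huvM : quad x y u v ∈ M)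
    (hutM : quad x y u t ∈ M) (hvwM : quad x y v w ∈ M) (h : quad x y u w ∈ K) :
    quad x y v t ∉ K := by
  intro h'
  obtain ⟨p, q, s, s', R, hB⟩ := hK
  have hcentre : ∀ z ∈ quad x y u w, z ∈ quad x y v t → z = x ∨ z = y := by
    intro z hz hz'
    rw [mem_quad] at hz hz'
    grind
  have hp := hcentre p (hB.p_mem h) (hB.p_mem h')
  have hq := hcentre q (hB.q_mem h) (hB.q_mem h')
  have hpq := hB.pq
  have hquad : ∀ u v, quad p q u v = quad x y u v := by
    intro u v
    rcases hp with rfl | rfl <;> rcases hq with rfl | rfl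
    · exact absurd rfl hpq
    · rfl
    · simp only [quad, Finset.insert_comm]
    · exact absurd rfl hpq
  have hne : ∀ b, Leaf M x y a e₀ e₁ b → b ≠ p ∧ b ≠ q := by
    intro b hb
    have := hb.ne
    grind
  have hnot : ∀ b c, quad x y b c ∈ M → quad p q b c ∉ K := by
    intro b c hbc hK
    rw [hquad] at hK
    exact Finset.disjoint_left.1 hKM hK hbc
  -- The hero owns the path `w v u t`. The spine joins `{u, w}` to `{v, t}`, so it can only be `w
  -- t`; but then `u` is a page, and `K` contains the edge `u t` of the hero.
  have key : ∀ s s', IsBook K p q s s' R → s ∈ quad x y u w → s' ∈ quad x y v t → False := by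
    intro s s' hB hs hs'
    have h1 := hB.ps
    have h2 := hB.qs
    have h3 := hB.pt
    have h4 := hB.qt
    have hs1 : s = u ∨ s = w := by rw [mem_quad] at hs; grind
    have hs2 : s' = v ∨ s' = t := by rw [mem_quad] at hs'; grind
    have hsp : quad p q s s' ∈ K := hB.spine_mem
    have hr : ∀ r ∈ R, quad p q s' r ∈ K := fun r hr => hB.right_mem hr
    rcases hs1 with rfl | rfl
    · rcases hs2 with rfl | rfl
      · exact hnot _ _ huvM hsp
      · exact hnot _ _ hutM hsp
    · rcases hs2 with rfl | rfl
      · exact hnot _ _ hvwM (quad_comm p q s s' ▸ hsp)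
      · have huR : u ∈ R := by
          have hsu : u ≠ s := by
            rintro rfl
            exact hnot _ _ hutM hsp
          exact hB.mem_pages h (mem_quad.2 (by simp)) (hne u hu).1 (hne u hu).2 hsu hut
        exact hnot _ _ hutM (quad_comm p q s' u ▸ hr u huR)
  have hdist : ∀ z, z ≠ p → z ≠ q → z ∈ quad x y u w → z ∉ quad x y v t := by
    intro z hzp hzq hz hz'
    have := hcentre z hz hz'
    grind
  rcases hB.s_or_t_mem h with h1 | h1
  · rcases hB.s_or_t_mem h' with h2 | h2
    · exact hdist s hB.ps.symm hB.qs.symm h1 h2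
    · exact key s s' hB h1 h2
  · rcases hB.s_or_t_mem h' with h2 | h2
    · exact key s' s hB.swapSpine h1 h2
    · exact hdist s' hB.pt.symm hB.qt.symm h1 h2

theorem core (P : Position M F G x y a e₀ e₁ n) {c r₁ r₂ r₃ : ℕ} (hc : Leaf M x y a e₀ e₁ c)
    (h₁ : Leaf M x y a e₀ e₁ r₁) (h₂ : Leaf M x y a e₀ e₁ r₂) (h₃ : Leaf M x y a e₀ e₁ r₃)
    (hne : c ≠ r₁ ∧ c ≠ r₂ ∧ c ≠ r₃) (h12 : r₁ ≠ r₂) (h13 : r₁ ≠ r₃) (h23 : r₂ ≠ r₃)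
    (hM₁ : quad x y c r₁ ∈ M) (hM₂ : quad x y c r₂ ∈ M) (hM₃ : quad x y c r₃ ∈ M) :
    Core M x y a c {r₁, r₂, r₃} where
  xy := P.xy
  xa := P.ax.1.symm
  xv := hc.ne.1.symm
  ya := P.ax.2.symm
  yv := hc.ne.2.symm
  av := hc.ne'.symm
  xQ := by simp [h₁.ne.1.symm, h₂.ne.1.symm, h₃.ne.1.symm]
  yQ := by simp [h₁.ne.2.symm, h₂.ne.2.symm, h₃.ne.2.symm]
  aQ := by simp [h₁.ne'.symm, h₂.ne'.symm, h₃.ne'.symm]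
  vQ := by simp [hne.1, hne.2.1, hne.2.2]
  card := Finset.card_eq_three.2 ⟨_, _, _, h12, h13, h23, rfl⟩
  spine := hc.mem
  left r hr := by
    simp only [Finset.mem_insert, Finset.mem_singleton] at hr
    rcases hr with rfl | rfl | rfl
    · exact h₁.mem
    · exact h₂.mem
    · exact h₃.mem
  right r hr := by
    simp only [Finset.mem_insert, Finset.mem_singleton] at hr
    rcases hr with rfl | rfl | rfl
    · exact hM₁
    · exact hM₂
    · exact hM₃

theorem core_disjoint (P : Position M F G x y a e₀ e₁ n) {c : ℕ} (hc : Leaf M x y a e₀ e₁ c) :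
    Disjoint e₀ {x, y, a, c} :=
  (P.quad_disjoint P.ha hc.h₀).symm

theorem nonempty (P : Position M F G x y a e₀ e₁ n) : e₀.Nonempty := by
  rw [← Finset.card_pos, P.card₀]
  omega

/-- `safe_zero`, `safe_one` and `safe_two` apply `Core.safe_of_lost` with no, one and two lost
edges; each lost edge lets the hero complete his core one move later. -/
theorem safe_zero (P : Position M F G x y a e₀ e₁ n) (hn : n ≤ 6) {c : ℕ} {Q : Finset ℕ}
    (hc : Leaf M x y a e₀ e₁ c) (hcore : Core M x y a c Q) : ¬ HasBook F ∧ Safe M F :=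
  hcore.safe_of_lost P.disj P.eq (Finset.empty_subset _)
    (P.card.trans (by simpa using hn)) (by simp) (P.core_disjoint hc) P.nonempty (by simp)
    (by simp) (by simp)

theorem safe_one (P : Position M F G x y a e₀ e₁ n) (hn : n ≤ 7) {c b b' : ℕ} {Q : Finset ℕ}
    (hc : Leaf M x y a e₀ e₁ c) (hb : Leaf M x y a e₀ e₁ b) (hb' : Leaf M x y a e₀ e₁ b')
    (h : quad x y b b' ∈ G) (hcore : Core M x y a c Q) : ¬ HasBook F ∧ Safe M F := by
  refine hcore.safe_of_lost (L := {quad x y b b'}) P.disj P.eq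
    (Finset.singleton_subset_iff.2 h) (P.card.trans (by simpa using hn)) (by simp)
    (P.core_disjoint hc) P.nonempty ?_ ?_ ?_
  · simp only [Finset.mem_singleton, forall_eq]
    exact P.quad_disjoint hb.h₀ hb'.h₀
  · simp only [Finset.mem_singleton, forall_eq]
    exact fun K hK hKM h' => P.notMem_of_quad_mem hK hKM hb hb' h'
  · simp only [Finset.mem_singleton, forall_eq]
    exact fun _ _ _ _ _ => trivial

theorem safe_two (P : Position M F G x y a e₀ e₁ n) (hn : n ≤ 8) {c u v w t : ℕ} {Q : Finset ℕ}
    (hc : Leaf M x y a e₀ e₁ c) (hu : Leaf M x y a e₀ e₁ u)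
    (hv : Leaf M x y a e₀ e₁ v) (hw : Leaf M x y a e₀ e₁ w) (ht : Leaf M x y a e₀ e₁ t)
    (huv : u ≠ v) (hut : u ≠ t) (hvw : v ≠ w) (hwt : w ≠ t) (huvM : quad x y u v ∈ M)
    (hutM : quad x y u t ∈ M) (hvwM : quad x y v w ∈ M) (h : quad x y u w ∈ G)
    (h' : quad x y v t ∈ G) (hcore : Core M x y a c Q) : ¬ HasBook F ∧ Safe M F := by
  have hne : quad x y u w ≠ quad x y v t := by
    rw [Ne, quad_eq_iff hu.ne hw.ne hv.ne ht.ne]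
    tauto
  have hcard : ({quad x y u w, quad x y v t} : Finset (Finset ℕ)).card = 2 :=
    Finset.card_pair hne
  have hinc : ∀ K, IsCopy K → Disjoint K M → quad x y u w ∈ K → quad x y v t ∉ K :=
    fun K hK hKM => P.notMem_of_quad_mem_of_quad_mem hK hKM hu hv hw ht huv hut hvw hwt huvM hutM
      hvwM
  refine hcore.safe_of_lost (L := {quad x y u w, quad x y v t}) P.disj P.eq
    (by simp [Finset.insert_subset_iff, h, h']) (P.card.trans (by omega)) (by omega)
    (P.core_disjoint hc) P.nonempty ?_ ?_ ?_
  · simp only [Finset.mem_insert, Finset.mem_singleton, forall_eq_or_imp, forall_eq]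
    exact ⟨P.quad_disjoint hu.h₀ hw.h₀, P.quad_disjoint hv.h₀ ht.h₀⟩
  · intro K hK hKM
    simp only [Finset.mem_insert, Finset.mem_singleton, forall_eq_or_imp, forall_eq]
    exact ⟨P.notMem_of_quad_mem hK hKM hu hw, P.notMem_of_quad_mem hK hKM hv ht⟩
  · intro K hK hKM
    have := hinc K hK hKM
    simp only [Finset.mem_insert, Finset.mem_singleton]
    grind

/-! ### The contest for a core among the leaves. -/

/-- The hero adds a new leaf to his star. -/
theorem playLeaf (P : Position M F G x y a e₀ e₁ n) (V : Finset ℕ)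
    (h : ∀ z : ℕ, z ∉ V → (∀ b, quad x y z b ∉ M) → (∀ b, quad x y z b ∉ F) →
      Leaf (insert (quad x y a z) M) x y a e₀ e₁ z → ∀ e : Finset ℕ,
      Position (insert (quad x y a z) M) (insert e F) (insert e G) x y a e₀ e₁ (n + 1) →
      ¬ HasBook (insert e F) ∧ Safe (insert (quad x y a z) M) (insert e F)) : Safe M F := by
  obtain ⟨z, hzV, hzM, hzF⟩ := exists_fresh M F (insert x (insert y (insert a V)))
  simp only [Finset.mem_insert, not_or] at hzV
  obtain ⟨hzx, hzy, hza, hzV⟩ := hzV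
  have hM : ∀ b, quad x y z b ∉ M := fun b h => hzM _ h (mem_quad.2 (by simp))
  have hF : ∀ b, quad x y z b ∉ F := fun b h => hzF _ h (mem_quad.2 (by simp))
  refine P.play P.ax ⟨hzx, hzy⟩ (Ne.symm hza) (quad_comm x y z a ▸ hM a)
    (quad_comm x y z a ▸ hF a) fun e P' => ?_
  refine h z hzV hM hF ⟨⟨hzx, hzy⟩, hza, ?_, ?_, Finset.mem_insert_self _ _⟩ e P'
  · exact hzF e₀ (by rw [P.eq]; exact Finset.mem_insert_self _ _)
  · exact hzF e₁ (by rw [P.eq]; exact Finset.mem_insert_of_mem (Finset.mem_insert_self _ _))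

/-- The opponent answered the edge `u v` at the leaf `u`. -/
theorem safe_of_adjacent (P : Position M F G x y a e₀ e₁ n) (hn : n ≤ 4) {u v w t : ℕ}
    (hu : Leaf M x y a e₀ e₁ u) (hv : Leaf M x y a e₀ e₁ v) (hw : Leaf M x y a e₀ e₁ w)
    (ht : Leaf M x y a e₀ e₁ t) (huv : u ≠ v) (huw : u ≠ w) (hut : u ≠ t) (hvw : v ≠ w)
    (hvt : v ≠ t) (hwt : w ≠ t) (huvM : quad x y u v ∈ M) (huwG : quad x y u w ∈ G)
    (hvwM : quad x y v w ∉ M) (hvwF : quad x y v w ∉ F) (hvtM : quad x y v t ∉ M)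
    (hvtF : quad x y v t ∉ F) (hutM : quad x y u t ∉ M) (hutF : quad x y u t ∉ F) :
    Safe M F := by
  have hun := hu.ne
  have hvn := hv.ne
  have hwn := hw.ne
  have htn := ht.ne
  have han := P.ax
  refine P.play hv.ne hw.ne hvw hvwM hvwF fun e P => ⟨P.not_hasBook (by omega), ?_⟩
  by_cases he : e = quad x y v t
  · subst he
    -- The hero completes the path `w v u t`, which makes `u w` and `v t` lost edges. After one more
    -- leaf `z`, both `z u` and `z v` finish a core, and the opponent can stop only one of them.
    refine P.play hu.ne ht.ne hut (by grind [quad_eq_iff]) (by grind [quad_eq_iff])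
      fun e P => ⟨P.not_hasBook (by omega), ?_⟩
    refine P.playLeaf {u, v, w, t} fun z hzV hzM hzF hz e' P => ⟨?_, ?_⟩
    · exact P.not_hasBook_of_mem (by omega) (((hu.insert _).insert _).insert _)
        (((hw.insert _).insert _).insert _) (by simp [huwG])
    simp only [Finset.mem_insert, Finset.mem_singleton, not_or] at hzV
    obtain ⟨hzu, hzv, hzw, hzt⟩ := hzV
    have hzn := hz.ne
    have hza := hz.ne'
    have hua := hu.ne'
    have hva := hv.ne'
    by_cases he' : e' = quad x y z u
    · refine P.play hzn hv.ne hzv ?_ ?_ fun e P => ?_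
      · have := hzM v
        grind [quad_eq_iff]
      · have := hzF v
        grind [quad_eq_iff]
      · refine P.safe_two (by omega) (c := v) (u := u) (v := v) (w := w) (t := t)
          ((((hv.insert _).insert _).insert _).insert _)
          ((((hu.insert _).insert _).insert _).insert _)
          ((((hv.insert _).insert _).insert _).insert _)
          ((((hw.insert _).insert _).insert _).insert _)
          ((((ht.insert _).insert _).insert _).insert _) huv hut hvw hwt
          (by simp [huvM]) (by simp) (by simp) (by simp [huwG]) (by simp)
          (P.core (r₁ := u) (r₂ := w) (r₃ := z)
            ((((hv.insert _).insert _).insert _).insert _)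
            ((((hu.insert _).insert _).insert _).insert _)
            ((((hw.insert _).insert _).insert _).insert _) (hz.insert _)
            ⟨huv.symm, hvw, Ne.symm hzv⟩ huw (Ne.symm hzu) (Ne.symm hzw) ?_ ?_ ?_)
        · simp [quad_comm x y v u, huvM]
        · simp
        · simp [quad_comm x y v z]
    · refine P.play hzn hu.ne hzu ?_ ?_ fun e P => ?_
      · have := hzM u
        grind [quad_eq_iff]
      · have := hzF u
        grind [quad_eq_iff]
      · refine P.safe_two (by omega) (c := u) (u := u) (v := v) (w := w) (t := t)
          ((((hu.insert _).insert _).insert _).insert _)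
          ((((hu.insert _).insert _).insert _).insert _)
          ((((hv.insert _).insert _).insert _).insert _)
          ((((hw.insert _).insert _).insert _).insert _)
          ((((ht.insert _).insert _).insert _).insert _) huv hut hvw hwt
          (by simp [huvM]) (by simp) (by simp) (by simp [huwG]) (by simp)
          (P.core (r₁ := t) (r₂ := v) (r₃ := z)
            ((((hu.insert _).insert _).insert _).insert _)
            ((((ht.insert _).insert _).insert _).insert _)
            ((((hv.insert _).insert _).insert _).insert _) (hz.insert _)
            ⟨hut, huv, Ne.symm hzu⟩ hvt.symm (Ne.symm hzt) (Ne.symm hzv) ?_ ?_ ?_)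
        · simp
        · simp [huvM]
        · simp [quad_comm x y u z]
  · refine P.play hv.ne ht.ne hvt (by grind [quad_eq_iff]) (by grind [quad_eq_iff]) fun e P => ?_
    refine P.safe_zero (by omega) ((hv.insert _).insert _)
      (P.core (r₁ := u) (r₂ := w) (r₃ := t) ((hv.insert _).insert _) ((hu.insert _).insert _)
        ((hw.insert _).insert _) ((ht.insert _).insert _) ⟨huv.symm, hvw, hvt⟩ huw hut hwt ?_ ?_ ?_)
    · simp [quad_comm x y v u, huvM]
    · simp
    · simp

/-- The hero has an edge `c d` between leaves, the opponent an edge `w t`, and there are three free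
edges from `c` to other leaves. -/
theorem safe_of_three_free (P : Position M F G x y a e₀ e₁ n) (hn : n ≤ 5) {c d w t z : ℕ}
    (hc : Leaf M x y a e₀ e₁ c) (hd : Leaf M x y a e₀ e₁ d) (hw : Leaf M x y a e₀ e₁ w)
    (ht : Leaf M x y a e₀ e₁ t) (hz : Leaf M x y a e₀ e₁ z) (hcd : c ≠ d) (hcw : c ≠ w)
    (hct : c ≠ t) (hcz : c ≠ z) (hdw : d ≠ w) (hdt : d ≠ t) (hdz : d ≠ z) (hwt : w ≠ t)
    (hwz : w ≠ z) (htz : t ≠ z) (hcdM : quad x y c d ∈ M) (hwtG : quad x y w t ∈ G)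
    (hcwM : quad x y c w ∉ M) (hcwF : quad x y c w ∉ F) (hctM : quad x y c t ∉ M)
    (hctF : quad x y c t ∉ F) (hczM : quad x y c z ∉ M) (hczF : quad x y c z ∉ F) :
    Safe M F := by
  have hcn := hc.ne
  have hdn := hd.ne
  have hwn := hw.ne
  have htn := ht.ne
  have hzn := hz.ne
  refine P.play hc.ne hw.ne hcw hcwM hcwF fun e P => ⟨P.not_hasBook (by omega), ?_⟩
  -- Both `c t` and `c z` finish a core, and one reply cannot take both.
  by_cases he : e = quad x y c t
  · refine P.play hc.ne hz.ne hcz (by grind [quad_eq_iff]) (by grind [quad_eq_iff]) fun e P => ?_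
    exact P.safe_one (by omega) (b := w) (b' := t) ((hc.insert _).insert _) ((hw.insert _).insert _)
      ((ht.insert _).insert _) (by simp [hwtG])
      (P.core (r₁ := d) (r₂ := w) (r₃ := z) ((hc.insert _).insert _) ((hd.insert _).insert _)
        ((hw.insert _).insert _) ((hz.insert _).insert _) ⟨hcd, hcw, hcz⟩ hdw hdz hwz
        (by simp [hcdM]) (by simp) (by simp))
  · refine P.play hc.ne ht.ne hct (by grind [quad_eq_iff]) (by grind [quad_eq_iff]) fun e P => ?_
    exact P.safe_one (by omega) (b := w) (b' := t) ((hc.insert _).insert _) ((hw.insert _).insert _)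
      ((ht.insert _).insert _) (by simp [hwtG])
      (P.core (r₁ := d) (r₂ := w) (r₃ := t) ((hc.insert _).insert _) ((hd.insert _).insert _)
        ((hw.insert _).insert _) ((ht.insert _).insert _) ⟨hcd, hcw, hct⟩ hdw hdt hwt
        (by simp [hcdM]) (by simp) (by simp))

/-- The hero has the edge `u v`, the opponent the opposite edge `w t`. -/
theorem safe_of_opposite (P : Position M F G x y a e₀ e₁ n) (hn : n ≤ 4) {u v w t : ℕ}
    (hu : Leaf M x y a e₀ e₁ u) (hv : Leaf M x y a e₀ e₁ v) (hw : Leaf M x y a e₀ e₁ w)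
    (ht : Leaf M x y a e₀ e₁ t) (huv : u ≠ v) (huw : u ≠ w) (hut : u ≠ t) (hvw : v ≠ w)
    (hvt : v ≠ t) (hwt : w ≠ t) (huvM : quad x y u v ∈ M) (hwtG : quad x y w t ∈ G)
    (huwM : quad x y u w ∉ M) (huwF : quad x y u w ∉ F) (hutM : quad x y u t ∉ M)
    (hutF : quad x y u t ∉ F) (hvwM : quad x y v w ∉ M) (hvwF : quad x y v w ∉ F)
    (hvtM : quad x y v t ∉ M) (hvtF : quad x y v t ∉ F) : Safe M F := by
  have hun := hu.ne
  have hvn := hv.ne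
  have hwn := hw.ne
  have htn := ht.ne
  have hua := hu.ne'
  have hva := hv.ne'
  have han := P.ax
  refine P.playLeaf {u, v, w, t} fun z hzV hzM hzF hz e P => ⟨P.not_hasBook (by omega), ?_⟩
  simp only [Finset.mem_insert, Finset.mem_singleton, not_or] at hzV
  obtain ⟨hzu, hzv, hzw, hzt⟩ := hzV
  have hzn := hz.ne
  have hza := hz.ne'
  have hzM' : ∀ b, quad x y b z ∉ M := fun b => quad_comm x y z b ▸ hzM b
  have hzF' : ∀ b, quad x y b z ∉ F := fun b => quad_comm x y z b ▸ hzF b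
  have hzMu := hzM' u
  have hzFu := hzF' u
  have hzMv := hzM' v
  have hzFv := hzF' v
  clear hzM hzF hzM' hzF'
  -- With the new leaf both `u` and `v` have free edges to `w`, `t`, `z`, and one reply spoils this
  -- for at most one of them.
  by_cases he : e = quad x y u w ∨ e = quad x y u t ∨ e = quad x y u z
  · refine P.safe_of_three_free (by omega) (c := v) (d := u) (hv.insert _) (hu.insert _)
      (hw.insert _) (ht.insert _) hz huv.symm hvw hvt (Ne.symm hzv) huw hut (Ne.symm hzu) hwt
      (Ne.symm hzw) (Ne.symm hzt) ?_ (by simp [hwtG]) ?_ ?_ ?_ ?_ ?_ ?_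
    · simp [quad_comm x y v u, huvM]
    all_goals grind [quad_eq_iff]
  · refine P.safe_of_three_free (by omega) (c := u) (d := v) (hu.insert _) (hv.insert _)
      (hw.insert _) (ht.insert _) hz huv huw hut (Ne.symm hzu) hvw hvt (Ne.symm hzv) hwt
      (Ne.symm hzw) (Ne.symm hzt) (by simp [huvM]) (by simp [hwtG]) ?_ ?_ ?_ ?_ ?_ ?_
    all_goals grind [quad_eq_iff]

/-- The hero has the edge `u v`, the opponent no edge between the leaves. -/
theorem safe_of_free (P : Position M F G x y a e₀ e₁ n) (hn : n ≤ 4) {u v w t : ℕ}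
    (hu : Leaf M x y a e₀ e₁ u) (hv : Leaf M x y a e₀ e₁ v) (hw : Leaf M x y a e₀ e₁ w)
    (ht : Leaf M x y a e₀ e₁ t) (huv : u ≠ v) (huw : u ≠ w) (hut : u ≠ t) (hvw : v ≠ w)
    (hvt : v ≠ t) (hwt : w ≠ t) (huvM : quad x y u v ∈ M)
    (huwM : quad x y u w ∉ M) (huwF : quad x y u w ∉ F) (hutM : quad x y u t ∉ M)
    (hutF : quad x y u t ∉ F) (hvwM : quad x y v w ∉ M) (hvwF : quad x y v w ∉ F)
    (hvtM : quad x y v t ∉ M) (hvtF : quad x y v t ∉ F) (hwtM : quad x y w t ∉ M)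
    (hwtF : quad x y w t ∉ F) : Safe M F := by
  have hun := hu.ne
  have hvn := hv.ne
  have hwn := hw.ne
  have htn := ht.ne
  refine P.play hu.ne hw.ne huw huwM huwF fun e P => ⟨P.not_hasBook (by omega), ?_⟩
  by_cases he : e = quad x y u t
  · subst he
    -- This closes the triangle `u v w`: both `v t` and `w t` finish a core, and the edge `u t` of
    -- the opponent is lost.
    refine P.play hv.ne hw.ne hvw (by grind [quad_eq_iff]) (by grind [quad_eq_iff])
      fun e P => ⟨P.not_hasBook (by omega), ?_⟩
    by_cases he : e = quad x y v t
    · refine P.play hw.ne ht.ne hwt (by grind [quad_eq_iff]) (by grind [quad_eq_iff])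
        fun e P => ?_
      refine P.safe_one (by omega) (b := u) (b' := t) (((hw.insert _).insert _).insert _)
        (((hu.insert _).insert _).insert _) (((ht.insert _).insert _).insert _) (by simp)
        (P.core (r₁ := u) (r₂ := v) (r₃ := t) (((hw.insert _).insert _).insert _)
          (((hu.insert _).insert _).insert _) (((hv.insert _).insert _).insert _)
          (((ht.insert _).insert _).insert _) ⟨huw.symm, hvw.symm, hwt⟩ huv hut hvt ?_ ?_ ?_)
      · simp [quad_comm x y w u]
      · simp [quad_comm x y w v]
      · simp
    · refine P.play hv.ne ht.ne hvt (by grind [quad_eq_iff]) (by grind [quad_eq_iff])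
        fun e P => ?_
      refine P.safe_one (by omega) (b := u) (b' := t) (((hv.insert _).insert _).insert _)
        (((hu.insert _).insert _).insert _) (((ht.insert _).insert _).insert _) (by simp)
        (P.core (r₁ := u) (r₂ := w) (r₃ := t) (((hv.insert _).insert _).insert _)
          (((hu.insert _).insert _).insert _) (((hw.insert _).insert _).insert _)
          (((ht.insert _).insert _).insert _) ⟨huv.symm, hvw, hvt⟩ huw hut hwt ?_ ?_ ?_)
      · simp [quad_comm x y v u, huvM]
      · simp
      · simp
  · refine P.play hu.ne ht.ne hut (by grind [quad_eq_iff]) (by grind [quad_eq_iff]) fun e P => ?_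
    exact P.safe_zero (by omega) ((hu.insert _).insert _)
      (P.core (r₁ := v) (r₂ := w) (r₃ := t) ((hu.insert _).insert _) ((hv.insert _).insert _)
        ((hw.insert _).insert _) ((ht.insert _).insert _) ⟨huv, huw, hut⟩ hvw hvt hwt
        (by simp [huvM]) (by simp) (by simp))

/-- The hero has a star with four leaves, and the opponent at most one edge between the leaves. -/
theorem safe_of_star (P : Position M F G x y a e₀ e₁ n) (hn : n ≤ 3) {u v w t : ℕ}
    (hu : Leaf M x y a e₀ e₁ u) (hv : Leaf M x y a e₀ e₁ v) (hw : Leaf M x y a e₀ e₁ w)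
    (ht : Leaf M x y a e₀ e₁ t) (huv : u ≠ v) (huw : u ≠ w) (hut : u ≠ t) (hvw : v ≠ w)
    (hvt : v ≠ t) (hwt : w ≠ t) (hM : ∀ e ∈ M, a ∈ e) (huvF : quad x y u v ∉ F)
    (huwF : quad x y u w ∉ F) (hutF : quad x y u t ∉ F) (hvwF : quad x y v w ∉ F)
    (hvtF : quad x y v t ∉ F) : Safe M F := by
  have hun := hu.ne
  have hvn := hv.ne
  have hwn := hw.ne
  have htn := ht.ne
  have han := P.ax
  have hfree : ∀ b c, Leaf M x y a e₀ e₁ b → Leaf M x y a e₀ e₁ c → quad x y b c ∉ M := by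
    intro b c hb hc h
    have h1 := mem_quad.1 (hM _ h)
    rcases h1 with h1 | h1 | h1 | h1
    · exact han.1 h1
    · exact han.2 h1
    · exact hb.ne' h1.symm
    · exact hc.ne' h1.symm
  have huwM := hfree u w hu hw
  have hutM := hfree u t hu ht
  have hvwM := hfree v w hv hw
  have hvtM := hfree v t hv ht
  have hwtM := hfree w t hw ht
  have huvM := hfree u v hu hv
  have huwM' : quad x y w u ∉ M := quad_comm x y u w ▸ huwM
  -- Among the leaves the opponent can own only `w t`, so the hero begins with the opposite edge.
  refine P.play hu.ne hv.ne huv huvM huvF fun e P => ⟨P.not_hasBook (by omega), ?_⟩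
  clear hfree hM
  replace hu := hu.insert (quad x y u v)
  replace hv := hv.insert (quad x y u v)
  replace hw := hw.insert (quad x y u v)
  replace ht := ht.insert (quad x y u v)
  have huvm : quad x y u v ∈ insert (quad x y u v) M := Finset.mem_insert_self _ _
  have hvum : quad x y v u ∈ insert (quad x y u v) M := quad_comm x y u v ▸ huvm
  by_cases h1 : e = quad x y u w
  · subst h1
    refine P.safe_of_adjacent (by omega) hu hv hw ht huv huw hut hvw hvt hwt huvm (by simp)
      ?_ ?_ ?_ ?_ ?_ ?_ <;> grind [quad_eq_iff]
  by_cases h2 : e = quad x y u t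
  · subst h2
    refine P.safe_of_adjacent (by omega) hu hv ht hw huv hut huw hvt hvw hwt.symm huvm (by simp)
      ?_ ?_ ?_ ?_ ?_ ?_ <;> grind [quad_eq_iff]
  by_cases h3 : e = quad x y v w
  · subst h3
    refine P.safe_of_adjacent (by omega) hv hu hw ht huv.symm hvw hvt huw hut hwt hvum (by simp)
      ?_ ?_ ?_ ?_ ?_ ?_ <;> grind [quad_eq_iff]
  by_cases h4 : e = quad x y v t
  · subst h4
    refine P.safe_of_adjacent (by omega) hv hu ht hw huv.symm hvt hvw hut huw hwt.symm hvum
      (by simp) ?_ ?_ ?_ ?_ ?_ ?_ <;> grind [quad_eq_iff]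
  by_cases h5 : quad x y w t ∈ insert e F
  · refine P.safe_of_opposite (by omega) hu hv hw ht huv huw hut hvw hvt hwt huvm
      (P.mem_of_mem hw h5) ?_ ?_ ?_ ?_ ?_ ?_ ?_ ?_ <;> grind [quad_eq_iff]
  · refine P.safe_of_free (by omega) hu hv hw ht huv huw hut hvw hvt hwt huvm
      ?_ ?_ ?_ ?_ ?_ ?_ ?_ ?_ ?_ h5 <;> grind [quad_eq_iff]

/-- The hero has a star with four leaves, and all edges of the opponent that contain `x` and `y` but
not `a` are equal, except for `e₀` and `e₁`. -/
theorem safe_of_subsingleton (P : Position M F G x y a e₀ e₁ n) (hn : n ≤ 3) {b₁ b₂ b₃ b₄ : ℕ}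
    (h₁ : Leaf M x y a e₀ e₁ b₁) (h₂ : Leaf M x y a e₀ e₁ b₂) (h₃ : Leaf M x y a e₀ e₁ b₃)
    (h₄ : Leaf M x y a e₀ e₁ b₄) (h12 : b₁ ≠ b₂) (h13 : b₁ ≠ b₃) (h14 : b₁ ≠ b₄) (h23 : b₂ ≠ b₃)
    (h24 : b₂ ≠ b₄) (h34 : b₃ ≠ b₄) (hM : ∀ e ∈ M, a ∈ e) {f : Finset ℕ}
    (hf : ∀ e ∈ G, x ∈ e → y ∈ e → a ∉ e → e = f) : Safe M F := by
  have han := P.ax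
  have hF : ∀ b c, Leaf M x y a e₀ e₁ b → Leaf M x y a e₀ e₁ c → quad x y b c ≠ f →
      quad x y b c ∉ F := by
    intro b c hb hc hne h
    refine hne (hf _ (P.mem_of_mem hb h) (mem_quad.2 (by simp)) (mem_quad.2 (by simp)) ?_)
    rw [mem_quad]
    have := hb.ne'
    have := hc.ne'
    grind
  -- The leaves are to be renamed so that the only pair that may be `f` becomes `w t`.
  have key : ∀ u v w t, Leaf M x y a e₀ e₁ u → Leaf M x y a e₀ e₁ v → Leaf M x y a e₀ e₁ w →
      Leaf M x y a e₀ e₁ t → u ≠ v → u ≠ w → u ≠ t → v ≠ w → v ≠ t → w ≠ t →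
      quad x y u v ≠ f → quad x y u w ≠ f → quad x y u t ≠ f → quad x y v w ≠ f →
      quad x y v t ≠ f → Safe M F := by
    intro u v w t hu hv hw ht huv huw hut hvw hvt hwt f1 f2 f3 f4 f5
    exact P.safe_of_star hn hu hv hw ht huv huw hut hvw hvt hwt hM (hF u v hu hv f1)
      (hF u w hu hw f2) (hF u t hu ht f3) (hF v w hv hw f4) (hF v t hv ht f5)
  have hn1 := h₁.ne
  have hn2 := h₂.ne
  have hn3 := h₃.ne
  have hn4 := h₄.ne
  by_cases c12 : quad x y b₁ b₂ = f
  · subst c12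
    apply key b₃ b₄ b₁ b₂ h₃ h₄ h₁ h₂ <;> grind [quad_eq_iff]
  by_cases c13 : quad x y b₁ b₃ = f
  · subst c13
    apply key b₂ b₄ b₁ b₃ h₂ h₄ h₁ h₃ <;> grind [quad_eq_iff]
  by_cases c14 : quad x y b₁ b₄ = f
  · subst c14
    apply key b₂ b₃ b₁ b₄ h₂ h₃ h₁ h₄ <;> grind [quad_eq_iff]
  by_cases c23 : quad x y b₂ b₃ = f
  · subst c23
    apply key b₁ b₄ b₂ b₃ h₁ h₄ h₂ h₃ <;> grind [quad_eq_iff]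
  by_cases c24 : quad x y b₂ b₄ = f
  · subst c24
    apply key b₁ b₃ b₂ b₄ h₁ h₃ h₂ h₄ <;> grind [quad_eq_iff]
  exact key b₁ b₂ b₃ b₄ h₁ h₂ h₃ h₄ h12 h13 h14 h23 h24 h34 c12 c13 c14 c23 c24

end Position

/-! ### Building the star and choosing `a` in its kernel. -/

theorem safe_addLeaf {M F : Finset (Finset ℕ)} {k₁ k₂ k₃ : ℕ} (h12 : k₁ ≠ k₂) (h13 : k₁ ≠ k₃)
    (h23 : k₂ ≠ k₃) (hF : F.card ≤ 7)
    (h : ∀ z, z ≠ k₁ → z ≠ k₂ → z ≠ k₃ → (∀ e ∈ M, z ∉ e) → (∀ e ∈ F, z ∉ e) →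
      ∀ e : Finset ℕ, e.card = 4 → e ∉ insert {k₁, k₂, k₃, z} M →
      Safe (insert {k₁, k₂, k₃, z} M) (insert e F)) : Safe M F := by
  obtain ⟨z, hz, hzM, hzF⟩ := exists_fresh M F {k₁, k₂, k₃}
  simp only [Finset.mem_insert, Finset.mem_singleton, not_or] at hz
  obtain ⟨hz1, hz2, hz3⟩ := hz
  refine Safe.step {k₁, k₂, k₃, z}
    (card_four h12 h13 (Ne.symm hz1) h23 (Ne.symm hz2) (Ne.symm hz3))
    (fun h => hzM _ h (by simp)) (fun h => hzF _ h (by simp)) fun e he heM => ⟨?_, ?_⟩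
  · exact not_hasBook_of_card ((Finset.card_insert_le _ _).trans_lt (by omega))
  · exact h z hz1 hz2 hz3 hzM hzF e he heM

/-- The index of the element of `{k₁, k₂, k₃}` that is missing from `e`, if `e` contains the two
others; otherwise `0`. -/
def omitted (k₁ k₂ k₃ : ℕ) (e : Finset ℕ) : ℕ :=
  if k₁ ∉ e ∧ k₂ ∈ e ∧ k₃ ∈ e then 1 else if k₂ ∉ e ∧ k₁ ∈ e ∧ k₃ ∈ e then 2
  else if k₃ ∉ e ∧ k₁ ∈ e ∧ k₂ ∈ e then 3 else 0

/-- The number `n₁` excludes one index, and among the other three numbers at most one index occurs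
twice; so one of the three indices is left. -/
theorem exists_avoided (n₁ n₂ n₃ n₄ : ℕ) :
    ∃ i, 1 ≤ i ∧ i ≤ 3 ∧ n₁ ≠ i ∧
      ((n₂ ≠ i ∧ n₃ ≠ i) ∨ (n₂ ≠ i ∧ n₄ ≠ i) ∨ (n₃ ≠ i ∧ n₄ ≠ i)) := by
  by_contra! h
  have h1 := h 1
  have h2 := h 2
  have h3 := h 3
  omega

/-- The hero owns a star with four leaves. -/
theorem safe_of_kernel {k₁ k₂ k₃ b₁ b₂ b₃ b₄ : ℕ} {e₀ e₁ e₂ e₃ e₄ : Finset ℕ}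
    {M F : Finset (Finset ℕ)}
    (hM : M = {{k₁, k₂, k₃, b₁}, {k₁, k₂, k₃, b₂}, {k₁, k₂, k₃, b₃}, {k₁, k₂, k₃, b₄}})
    (hF : F = insert e₀ (insert e₁ {e₂, e₃, e₄})) (hd : Disjoint F M)
    (h12 : k₁ ≠ k₂) (h13 : k₁ ≠ k₃) (h23 : k₂ ≠ k₃) (hk₁ : k₁ ∉ e₀) (hk₂ : k₂ ∉ e₀) (hk₃ : k₃ ∉ e₀)
    (h₀ : e₀.card = 4) (h₁ : e₁.card = 4)
    (hb : ∀ b ∈ ({b₁, b₂, b₃, b₄} : Finset ℕ), b ≠ k₁ ∧ b ≠ k₂ ∧ b ≠ k₃ ∧ b ∉ e₀ ∧ b ∉ e₁)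
    (g12 : b₁ ≠ b₂) (g13 : b₁ ≠ b₃) (g14 : b₁ ≠ b₄) (g23 : b₂ ≠ b₃) (g24 : b₂ ≠ b₄)
    (g34 : b₃ ≠ b₄) : Safe M F := by
  have key : ∀ x y a, x ≠ y → a ≠ x ∧ a ≠ y → x ∉ e₀ → y ∉ e₀ → a ∉ e₀ →
      (∀ b ∈ ({b₁, b₂, b₃, b₄} : Finset ℕ), b ≠ x ∧ b ≠ y ∧ b ≠ a) →
      (∀ b, quad x y a b = {k₁, k₂, k₃, b}) → ¬ (a ∉ e₁ ∧ x ∈ e₁ ∧ y ∈ e₁) →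
      ((¬ (a ∉ e₂ ∧ x ∈ e₂ ∧ y ∈ e₂) ∧ ¬ (a ∉ e₃ ∧ x ∈ e₃ ∧ y ∈ e₃)) ∨
        (¬ (a ∉ e₂ ∧ x ∈ e₂ ∧ y ∈ e₂) ∧ ¬ (a ∉ e₄ ∧ x ∈ e₄ ∧ y ∈ e₄)) ∨
        (¬ (a ∉ e₃ ∧ x ∈ e₃ ∧ y ∈ e₃) ∧ ¬ (a ∉ e₄ ∧ x ∈ e₄ ∧ y ∈ e₄))) → Safe M F := by
    intro x y a hxy hax hx hy ha hbk hquad hgood hmost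
    have P : Position M F {e₂, e₃, e₄} x y a e₀ e₁ 3 :=
      { xy := hxy
        ax := hax
        hx := hx
        hy := hy
        ha := ha
        card₀ := h₀
        card₁ := h₁
        good := fun hx hy => by_contra fun ha => hgood ⟨ha, hx, hy⟩
        disj := hd
        eq := hF
        card := Finset.card_le_three }
    have hleaf : ∀ b ∈ ({b₁, b₂, b₃, b₄} : Finset ℕ), Leaf M x y a e₀ e₁ b := by
      intro b hbm
      obtain ⟨-, -, -, hb0, hb1⟩ := hb b hbm
      obtain ⟨hbx, hby, hba⟩ := hbk b hbm
      refine ⟨⟨hbx, hby⟩, hba, hb0, hb1, ?_⟩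
      rw [hquad, hM]
      simp only [Finset.mem_insert, Finset.mem_singleton] at hbm ⊢
      rcases hbm with rfl | rfl | rfl | rfl <;> simp
    -- `f` is the one edge that the choice of `a` leaves unrestricted.
    obtain ⟨f, hf⟩ : ∃ f, ∀ e ∈ ({e₂, e₃, e₄} : Finset (Finset ℕ)), x ∈ e → y ∈ e → a ∉ e →
        e = f := by
      simp only [Finset.mem_insert, Finset.mem_singleton, forall_eq_or_imp, forall_eq]
      rcases hmost with h | h | h
      · exact ⟨e₄, fun hx hy ha => absurd ⟨ha, hx, hy⟩ h.1, fun hx hy ha => absurd ⟨ha, hx, hy⟩ h.2,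
          fun _ _ _ => rfl⟩
      · exact ⟨e₃, fun hx hy ha => absurd ⟨ha, hx, hy⟩ h.1, fun _ _ _ => rfl,
          fun hx hy ha => absurd ⟨ha, hx, hy⟩ h.2⟩
      · exact ⟨e₂, fun _ _ _ => rfl, fun hx hy ha => absurd ⟨ha, hx, hy⟩ h.1,
          fun hx hy ha => absurd ⟨ha, hx, hy⟩ h.2⟩
    refine P.safe_of_subsingleton le_rfl (hleaf b₁ (by simp)) (hleaf b₂ (by simp))
      (hleaf b₃ (by simp)) (hleaf b₄ (by simp)) g12 g13 g14 g23 g24 g34 ?_ hf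
    intro e he
    have hall : ∀ b, a ∈ ({k₁, k₂, k₃, b} : Finset ℕ) := by
      intro b
      rw [← hquad, mem_quad]
      simp
    rw [hM] at he
    simp only [Finset.mem_insert, Finset.mem_singleton] at he
    rcases he with rfl | rfl | rfl | rfl <;> exact hall _
  have hτ₁ : ∀ e, (k₁ ∉ e ∧ k₂ ∈ e ∧ k₃ ∈ e) → omitted k₁ k₂ k₃ e = 1 := by
    intro e he
    simp [omitted, he]
  have hτ₂ : ∀ e, (k₂ ∉ e ∧ k₁ ∈ e ∧ k₃ ∈ e) → omitted k₁ k₂ k₃ e = 2 := by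
    intro e he
    simp [omitted, he]
  have hτ₃ : ∀ e, (k₃ ∉ e ∧ k₁ ∈ e ∧ k₂ ∈ e) → omitted k₁ k₂ k₃ e = 3 := by
    intro e he
    simp [omitted, he]
  obtain ⟨i, hi1, hi3, hne, hmost⟩ := exists_avoided (omitted k₁ k₂ k₃ e₁) (omitted k₁ k₂ k₃ e₂)
    (omitted k₁ k₂ k₃ e₃) (omitted k₁ k₂ k₃ e₄)
  -- The kernel vertex with index `i` becomes `a`, the other two become the centres `x`, `y`.
  obtain rfl | rfl | rfl : i = 1 ∨ i = 2 ∨ i = 3 := by omega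
  · refine key k₂ k₃ k₁ h23 ⟨h12, h13⟩ hk₂ hk₃ hk₁ (fun b hbm => ?_) (fun b => ?_)
      (mt (hτ₁ e₁) hne) (hmost.imp (And.imp (mt (hτ₁ _)) (mt (hτ₁ _)))
        (Or.imp (And.imp (mt (hτ₁ _)) (mt (hτ₁ _))) (And.imp (mt (hτ₁ _)) (mt (hτ₁ _)))))
    · obtain ⟨h1, h2, h3, -⟩ := hb b hbm
      exact ⟨h2, h3, h1⟩
    · ext z
      simp only [mem_quad, Finset.mem_insert, Finset.mem_singleton]
      tauto
  · refine key k₁ k₃ k₂ h13 ⟨h12.symm, h23⟩ hk₁ hk₃ hk₂ (fun b hbm => ?_) (fun b => ?_)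
      (mt (hτ₂ e₁) hne) (hmost.imp (And.imp (mt (hτ₂ _)) (mt (hτ₂ _)))
        (Or.imp (And.imp (mt (hτ₂ _)) (mt (hτ₂ _))) (And.imp (mt (hτ₂ _)) (mt (hτ₂ _)))))
    · obtain ⟨h1, h2, h3, -⟩ := hb b hbm
      exact ⟨h1, h3, h2⟩
    · ext z
      simp only [mem_quad, Finset.mem_insert, Finset.mem_singleton]
      tauto
  · refine key k₁ k₂ k₃ h12 ⟨h13.symm, h23.symm⟩ hk₁ hk₂ hk₃ (fun b hbm => ?_) (fun b => rfl)
      (mt (hτ₃ e₁) hne) (hmost.imp (And.imp (mt (hτ₃ _)) (mt (hτ₃ _)))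
        (Or.imp (And.imp (mt (hτ₃ _)) (mt (hτ₃ _))) (And.imp (mt (hτ₃ _)) (mt (hτ₃ _)))))
    obtain ⟨h1, h2, h3, -⟩ := hb b hbm
    exact ⟨h1, h2, h3⟩

/-- The hero owns one edge, and the opponent owns two. -/
theorem safe_of_one_edge {k₁ k₂ k₃ b₁ : ℕ} {e₀ e₁ : Finset ℕ} (h12 : k₁ ≠ k₂) (h13 : k₁ ≠ k₃)
    (h23 : k₂ ≠ k₃) (hk₁ : k₁ ∉ e₀) (hk₂ : k₂ ∉ e₀) (hk₃ : k₃ ∉ e₀) (h₀ : e₀.card = 4)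
    (h₁ : e₁.card = 4)
    (hb₁ : b₁ ≠ k₁ ∧ b₁ ≠ k₂ ∧ b₁ ≠ k₃ ∧ b₁ ∉ e₀ ∧ b₁ ∉ e₁) :
    Safe {{k₁, k₂, k₃, b₁}} {e₁, e₀} := by
  have hmem : ∀ b : ℕ, b ∈ ({k₁, k₂, k₃, b} : Finset ℕ) := by simp
  have hrev : ∀ a b c d : Finset ℕ, ({d, c, b, a} : Finset (Finset ℕ)) = {a, b, c, d} := by
    intro a b c d
    ext z
    simp only [Finset.mem_insert, Finset.mem_singleton]
    grind
  have hrot : ∀ a b c d e : Finset ℕ,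
      ({e, d, c, b, a} : Finset (Finset ℕ)) = insert a (insert b {c, d, e}) := by
    intro a b c d e
    ext z
    simp only [Finset.mem_insert, Finset.mem_singleton]
    grind
  refine safe_addLeaf h12 h13 h23 (Finset.card_le_two.trans (by omega))
    fun b₂ c1 c2 c3 hM₂ hF₂ e₂ _ hd₂ => ?_
  refine safe_addLeaf h12 h13 h23 (Finset.card_le_three.trans (by omega))
    fun b₃ d1 d2 d3 hM₃ hF₃ e₃ _ hd₃ => ?_
  refine safe_addLeaf h12 h13 h23 (Finset.card_le_four.trans (by omega))
    fun b₄ f1 f2 f3 hM₄ hF₄ e₄ _ hd₄ => ?_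
  simp only [Finset.mem_insert, Finset.mem_singleton, forall_eq_or_imp, forall_eq, not_or]
    at hM₂ hM₃ hM₄ hF₂ hF₃ hF₄ hd₂ hd₃ hd₄
  refine safe_of_kernel (b₁ := b₁) (b₂ := b₂) (b₃ := b₃) (b₄ := b₄) (e₀ := e₀) (e₁ := e₁)
    (e₂ := e₂) (e₃ := e₃) (e₄ := e₄) (k₁ := k₁) (k₂ := k₂) (k₃ := k₃) ?_ ?_ ?_ h12 h13 h23 hk₁ hk₂
    hk₃ h₀ h₁ ?_ ?_ ?_ ?_ ?_ ?_ ?_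
  · exact hrev _ _ _ _
  · exact hrot _ _ _ _ _
  · have hsep : ∀ (e : Finset ℕ) b, b ∉ e → e ≠ {k₁, k₂, k₃, b} := by
      rintro e b hb rfl
      exact hb (hmem b)
    rw [Finset.disjoint_left]
    intro e he
    simp only [Finset.mem_insert, Finset.mem_singleton, not_or] at he ⊢
    rcases he with rfl | rfl | rfl | rfl | rfl
    · exact ⟨hd₄.1, hd₄.2.1, hd₄.2.2.1, hd₄.2.2.2⟩
    · exact ⟨hsep _ _ hF₄.1, hd₃.1, hd₃.2.1, hd₃.2.2⟩
    · exact ⟨hsep _ _ hF₄.2.1, hsep _ _ hF₃.1, hd₂.1, hd₂.2⟩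
    · exact ⟨hsep _ _ hF₄.2.2.1, hsep _ _ hF₃.2.1, hsep _ _ hF₂.1, hsep _ _ hb₁.2.2.2.2⟩
    · exact ⟨hsep _ _ hF₄.2.2.2, hsep _ _ hF₃.2.2, hsep _ _ hF₂.2, hsep _ _ hb₁.2.2.2.1⟩
  · intro b hbm
    simp only [Finset.mem_insert, Finset.mem_singleton] at hbm
    rcases hbm with rfl | rfl | rfl | rfl
    · exact hb₁
    · exact ⟨c1, c2, c3, hF₂.2, hF₂.1⟩
    · exact ⟨d1, d2, d3, hF₃.2.2, hF₃.2.1⟩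
    · exact ⟨f1, f2, f3, hF₄.2.2.2, hF₄.2.2.1⟩
  all_goals
    rintro rfl
    simp_all

/-- The hero is safe if the opponent owns one edge and the hero, who owns nothing, is to move. -/
theorem safe_start (e₀ : Finset ℕ) (h₀ : e₀.card = 4) : Safe ∅ {e₀} := by
  obtain ⟨z₁, hz₁, -⟩ := exists_fresh ∅ ∅ e₀
  obtain ⟨z₂, hz₂, -⟩ := exists_fresh ∅ ∅ (insert z₁ e₀)
  obtain ⟨z₃, hz₃, -⟩ := exists_fresh ∅ ∅ (insert z₂ (insert z₁ e₀))
  refine safe_addLeaf (k₁ := z₁) (k₂ := z₂) (k₃ := z₃) (by grind) (by grind) (by grind) (by simp)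
    fun z₄ c1 c2 c3 _ hF e₁ h₁ hd => ?_
  have hf : ∀ z ∈ ({z₁, z₂, z₃, z₄} : Finset ℕ), z ∉ e₀ := by
    have := hF e₀ (by simp)
    grind
  have hcard : ({z₁, z₂, z₃, z₄} : Finset ℕ).card = 4 :=
    card_four (by grind) (by grind) c1.symm (by grind) c2.symm c3.symm
  set f : Finset ℕ := {z₁, z₂, z₃, z₄}
  -- The first edge of the hero differs from `e₁` and has the same size. A vertex of it outside `e₁`
  -- serves as the first leaf and the other three as the kernel, so that even this leaf avoids `e₁`.
  obtain ⟨b, hbf, hbe⟩ : ∃ b ∈ f, b ∉ e₁ := by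
    by_contra! hcon
    have := Finset.eq_of_subset_of_card_le hcon (by omega)
    simp [this] at hd
  have h3 : (f.erase b).card = 3 := by
    rw [Finset.card_erase_of_mem hbf, hcard]
  obtain ⟨k₁, k₂, k₃, h12, h13, h23, hk⟩ := Finset.card_eq_three.1 h3
  have hfk : f = {k₁, k₂, k₃, b} := by
    rw [← Finset.insert_erase hbf, hk]
    ext z
    simp only [Finset.mem_insert, Finset.mem_singleton]
    tauto
  have hkf : ∀ k ∈ ({k₁, k₂, k₃} : Finset ℕ), k ≠ b ∧ k ∉ e₀ := by
    intro k hk'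
    rw [← hk, Finset.mem_erase] at hk'
    exact ⟨hk'.1, hf k hk'.2⟩
  simp only [Finset.mem_insert, Finset.mem_singleton, forall_eq_or_imp, forall_eq] at hkf
  rw [insert_empty_eq, hfk]
  exact safe_of_one_edge h12 h13 h23 hkf.1.2 hkf.2.1.2 hkf.2.2.2 h₀ h₁
    ⟨hkf.1.1.symm, hkf.2.1.1.symm, hkf.2.2.1.symm, hf b hbf, hbe⟩

theorem theorem2 : RamseyGameIsDraw Komega4 (addTwoCentres K6minusK4) := by
  exact isDraw_of_safe safe_start
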